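/- Setting. Let $B_{1,n}$ ($n\ge 1$) be the Artin group of type B with generators $t,\sigma_1,\dots,\sigma_{n-1}$ and relations $\sigma_1t\sigma_1t=t\sigma_1t\sigma_1$, $t\sigma_i=\sigma_it$ ($i>1$), $\sigma_i\sigma_{i+1}\sigma_i=\sigma_{i+1}\sigma_i\sigma_{i+1}$, $\sigma_i\sigma_j=\sigma_j\sigma_i$ ($|i-j|>1$). Put $t_0=t_0'=t$, $t_i=\sigma_i\cdots\sigma_1t\sigma_1\cdots\sigma_i$ and $t_i'=\sigma_i\cdots\sigma_1t\sigma_1^{-1}\cdots\sigma_i^{-1}$. Let $K$ be a commutative ring with units $q$, $z$, $\sqrt\lambda$ such that $\lambda=(\sqrt\lambda)^2=\frac{z+1-q}{qz}$. Let $\mathrm H_{1,n}(q)$ be the quotient of the group algebra $K B_{1,n}$ by the relations $\sigma_i^2=(q-1)\sigma_i+q$, let $\pi$ be the canonical map, and put $g_i=\pi(\sigma_i)$; write $t_n'$ also for $\pi(t_n')$. Let $\mathrm{tr}:\bigcup_n \mathrm H_{1,n}(q)\to K[s_k : k\in\mathbb Z\setminus\{0\}]$ be Lambropoulou's Markov trace,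 that is, the unique $K$-linear function (compatible with the maps $\mathrm H_{1,n}(q)\to\mathrm H_{1,n+1}(q)$) with $\mathrm{tr}(ab)=\mathrm{tr}(ba)$, $\mathrm{tr}(1)=1$, $\mathrm{tr}(ag_n)=z\,\mathrm{tr}(a)$ and $\mathrm{tr}(a\,{t_n'}^{k})=s_k\,\mathrm{tr}(a)$ for $a,b\in \mathrm H_{1,n}(q)$ (in the last two rules the product lies in $\mathrm H_{1,n+1}(q)$) and $k\in\mathbb Z\setminus\{0\}$. For $\alpha\in B_{1,n}$ let $$X_{\widehat\alpha}=\Big[\frac{1}{z\sqrt\lambda}\Big]^{n-1}(\sqrt\lambda)^{e}\,\mathrm{tr}(\pi(\alpha)),$$ where $e$ is the exponent sum of the $\sigma_i$ in $\alpha$ (with $t$ counting $0$); when $1-q$ is invertible, $\frac1{z\sqrt\lambda}=-\frac{1-\lambda q}{\sqrt\lambda(1-q)}$. Braid band moves. Fix $p\in\mathbb Z$. For $\alpha\in B_{1,n}$ let $\alpha_+\in B_{1,n+1}$ be its image under the homomorphism $\sigma_i\mapsto\sigma_{i+1}$, $t\mapsto t_1$ (so $t_i\mapsto t_{i+1}$).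 The positive or negative braid band move on the first moving strand is $sl_{\pm1}(\alpha)=t^p\sigma_1^{\pm1}\alpha_+\in B_{1,n+1}$, and on the $i$-th moving strand, $1\le i\le n$, it is $sl_{\pm i}(\beta)=sl_{\pm1}\big((\sigma_1^{-1}\cdots\sigma_{i-1}^{-1})\,\beta\,(\sigma_{i-1}\cdots\sigma_1)\big)$. The two sets. A braiding tail on $n$ strands is a word $\prod_{i=1}^{n-1}(\sigma_i\sigma_{i-1}\cdots\sigma_{i-d_i+1})$, $0\le d_i\le i$, taken in the order $i=1,\dots,n-1$ (Jones' basis of the Hecke algebra $\mathrm H_n(q)$ of type A). Let $\Sigma_n\subset B_{1,n}$ be the set of all $t_0^{k_0}t_1^{k_1}\cdots t_{n-1}^{k_{n-1}}\cdot w$ with $k_i\in\mathbb Z$ (possibly $0$, i.e. gaps are allowed) and $w$ a braiding tail on $n$ strands, and $\Sigma=\bigcup_{n\ge1}\Sigma_n$. Let $L$ be the set of all monomials $t_0^{k_0}t_1^{k_1}\cdots t_m^{k_m}$, $m\ge0$, with all $k_i\in\mathbb Z\setminus\{0\}$ (no gaps). Statement. The following two infinite systems of equations in the unknowns $s_k$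 are equivalent: (1) $X_{\widehat\alpha}=X_{\widehat{sl_{\pm1}(\alpha)}}$ for all $\alpha\in\Sigma$ (both signs); (2) $X_{\widehat\beta}=X_{\widehat{sl_{\pm i}(\beta)}}$ for all $n\ge1$, all $\beta=\tau w\in B_{1,n}$ with $\tau=t_0^{k_0}\cdots t_m^{k_m}\in L$, $m+1\le n$, and $w$ a braiding tail on $n$ strands, and all $1\le i\le n$ (both signs). Precisely: the differences of the two sides of the equations (1) and those of the equations (2) span the same $K$-submodule of $K[s_k : k\in\mathbb Z\setminus\{0\}]$; moreover the two systems have the same solutions $(s_k)$ in every commutative $K$-algebra. -/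

import Mathlib

/-! ### The mixed braid groups `B_{1,n}` (Artin groups of type B) -/

/-- Generators of `B_{1,n}`: the loop `t` and the crossings `σ_i`, `1 ≤ i ≤ n - 1`. -/
inductive BraidGen (n : ℕ) : Type
  | t : BraidGen n
  | sigma (i : ℕ) (hi : 1 ≤ i ∧ i < n) : BraidGen n

/-- The defining relations of `B_{1,n}`. -/
inductive BraidRel (n : ℕ) : FreeGroup (BraidGen n) → FreeGroup (BraidGen n) → Prop
  | four (h : 1 ≤ 1 ∧ 1 < n) :
      BraidRel n
        (.of (.sigma 1 h) * .of .t * .of (.sigma 1 h) * .of .t)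
        (.of .t * .of (.sigma 1 h) * .of .t * .of (.sigma 1 h))
  | loop_comm (i : ℕ) (hi : 1 ≤ i ∧ i < n) (h : 1 < i) :
      BraidRel n (.of .t * .of (.sigma i hi)) (.of (.sigma i hi) * .of .t)
  | braid (i : ℕ) (hi : 1 ≤ i ∧ i < n) (hj : 1 ≤ i + 1 ∧ i + 1 < n) :
      BraidRel n
        (.of (.sigma i hi) * .of (.sigma (i + 1) hj) * .of (.sigma i hi))
        (.of (.sigma (i + 1) hj) * .of (.sigma i hi) * .of (.sigma (i + 1) hj))
  | far (i j : ℕ) (hi : 1 ≤ i ∧ i < n) (hj : 1 ≤ j ∧ j < n) (h : i + 1 < j) :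
      BraidRel n
        (.of (.sigma i hi) * .of (.sigma j hj)) (.of (.sigma j hj) * .of (.sigma i hi))

/-- The mixed braid group `B_{1,n}` with `n` moving strands. -/
abbrev BraidB (n : ℕ) : Type :=
  PresentedGroup {r : FreeGroup (BraidGen n) | ∃ x y, BraidRel n x y ∧ r = x * y⁻¹}

namespace BraidB

/-- The loop generator `t`. -/
def t (n : ℕ) : BraidB n := PresentedGroup.of BraidGen.t

/-- The crossing `σ_i` for `1 ≤ i ≤ n - 1` (and `1` outside that range, which is never used). -/
def sigma (n i : ℕ) : BraidB n :=
  if h : 1 ≤ i ∧ i < n then PresentedGroup.of (BraidGen.sigma i h) else 1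

/-- `t_i = σ_i ⋯ σ_1 t σ_1 ⋯ σ_i`, with `t_0 = t`. -/
def loop (n : ℕ) : ℕ → BraidB n
  | 0 => t n
  | i + 1 => sigma n (i + 1) * loop n i * sigma n (i + 1)

/-- `t'_i = σ_i ⋯ σ_1 t σ_1⁻¹ ⋯ σ_i⁻¹`, with `t'_0 = t`. -/
def loop' (n : ℕ) : ℕ → BraidB n
  | 0 => t n
  | i + 1 => sigma n (i + 1) * loop' n i * (sigma n (i + 1))⁻¹

/-- The descending block `σ_i σ_{i-1} ⋯ σ_{i-m+1}` of length `m` (used for `m ≤ i`). -/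
def desc (n i m : ℕ) : BraidB n := ((List.range m).map fun j => sigma n (i - j)).prod

theorem sigma_of {n i : ℕ} (h : 1 ≤ i ∧ i < n) :
    sigma n i = PresentedGroup.of (BraidGen.sigma i h) := by
  simp [sigma, h]

theorem of_rel {n : ℕ} {x y : FreeGroup (BraidGen n)} (h : BraidRel n x y) :
    PresentedGroup.mk {r : FreeGroup (BraidGen n) | ∃ x y, BraidRel n x y ∧ r = x * y⁻¹} x =
      PresentedGroup.mk _ y := by
  have h1 := PresentedGroup.one_of_mem (rels :=
    {r : FreeGroup (BraidGen n) | ∃ x y, BraidRel n x y ∧ r = x * y⁻¹}) ⟨x, y, h, rfl⟩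
  rw [map_mul, map_inv] at h1
  exact mul_inv_eq_one.mp h1

theorem four {n : ℕ} (h : 1 < n) :
    sigma n 1 * t n * sigma n 1 * t n = t n * sigma n 1 * t n * sigma n 1 := by
  have := of_rel (BraidRel.four ⟨le_refl 1, h⟩)
  simp only [map_mul] at this
  rw [sigma_of (⟨le_refl 1, h⟩ : 1 ≤ 1 ∧ 1 < n)]
  exact this

theorem t_comm {n i : ℕ} (h1 : 1 < i) (h : i < n) : t n * sigma n i = sigma n i * t n := by
  have hi : 1 ≤ i ∧ i < n := ⟨h1.le, h⟩
  have := of_rel (BraidRel.loop_comm i hi h1)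
  simp only [map_mul] at this
  rw [sigma_of hi]
  exact this

theorem braid {n i : ℕ} (h1 : 1 ≤ i) (h : i + 1 < n) :
    sigma n i * sigma n (i + 1) * sigma n i =
      sigma n (i + 1) * sigma n i * sigma n (i + 1) := by
  have hi : 1 ≤ i ∧ i < n := ⟨h1, by omega⟩
  have hj : 1 ≤ i + 1 ∧ i + 1 < n := ⟨by omega, h⟩
  have := of_rel (BraidRel.braid i hi hj)
  simp only [map_mul] at this
  rw [sigma_of hi, sigma_of hj]
  exact this

theorem far {n i j : ℕ} (h1 : 1 ≤ i) (hij : i + 1 < j) (h : j < n) :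
    sigma n i * sigma n j = sigma n j * sigma n i := by
  have hi : 1 ≤ i ∧ i < n := ⟨h1, by omega⟩
  have hj : 1 ≤ j ∧ j < n := ⟨by omega, h⟩
  have := of_rel (BraidRel.far i j hi hj hij)
  simp only [map_mul] at this
  rw [sigma_of hi, sigma_of hj]
  exact this

/-- A homomorphism out of `B_{1,n}`, given by images of the generators. -/
def lift {n : ℕ} {G : Type*} [Group G] (f : BraidGen n → G)
    (hf : ∀ x y, BraidRel n x y → FreeGroup.lift f x = FreeGroup.lift f y) : BraidB n →* G :=
  PresentedGroup.toGroup (f := f) (by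
    rintro r ⟨x, y, h, rfl⟩
    rw [map_mul, map_inv, hf x y h, mul_inv_cancel])

/-- The inclusion `B_{1,n} → B_{1,n+1}` adding a trivial last strand. -/
def incl (n : ℕ) : BraidB n →* BraidB (n + 1) :=
  lift (fun
    | .t => t (n + 1)
    | .sigma i _ => sigma (n + 1) i) (by
    intro x y h
    cases h with
    | four h => simpa using four (n := n + 1) (by omega)
    | loop_comm i hi h => simpa using t_comm (n := n + 1) h (by omega)
    | braid i hi hj => simpa using braid (n := n + 1) hi.1 (by omega)
    | far i j hi hj h => simpa using far (n := n + 1) hi.1 h (by omega))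

theorem shift_four {G : Type*} [Group G] (t a b : G) (h4 : a * t * a * t = t * a * t * a)
    (hb : t * b = b * t) (hab : a * b * a = b * a * b) :
    b * (a * t * a) * b * (a * t * a) = (a * t * a) * b * (a * t * a) * b := by
  have l : b * (a * t * a) * b * (a * t * a) = a * b * (a * t * a * t) * b * a := by
    calc b * (a * t * a) * b * (a * t * a)
        = b * a * t * (a * b * a) * t * a := by group
      _ = b * a * t * (b * a * b) * t * a := by rw [hab]
      _ = b * a * (t * b) * a * (b * t) * a := by group
      _ = b * a * (b * t) * a * (t * b) * a := by rw [hb]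
      _ = (b * a * b) * t * a * t * b * a := by group
      _ = (a * b * a) * t * a * t * b * a := by rw [hab]
      _ = a * b * (a * t * a * t) * b * a := by group
  have r : (a * t * a) * b * (a * t * a) * b = a * b * (t * a * t * a) * b * a := by
    calc (a * t * a) * b * (a * t * a) * b
        = a * t * (a * b * a) * t * a * b := by group
      _ = a * t * (b * a * b) * t * a * b := by rw [hab]
      _ = a * (t * b) * a * (b * t) * a * b := by group
      _ = a * (b * t) * a * (t * b) * a * b := by rw [hb]
      _ = a * b * t * a * t * (b * a * b) := by group
      _ = a * b * t * a * t * (a * b * a) := by rw [hab]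
      _ = a * b * (t * a * t * a) * b * a := by group
  rw [l, r, h4]

/-- The index shift `α ↦ α₊` from `B_{1,n}` to `B_{1,n+1}`: `σ_i ↦ σ_{i+1}` and
`t = t_0 ↦ t_1 = σ_1 t σ_1`. -/
def shift (n : ℕ) : BraidB n →* BraidB (n + 1) :=
  lift (fun
    | .t => sigma (n + 1) 1 * t (n + 1) * sigma (n + 1) 1
    | .sigma i _ => sigma (n + 1) (i + 1)) (by
    intro x y h
    cases h with
    | four h =>
      have := shift_four (t (n + 1)) (sigma (n + 1) 1) (sigma (n + 1) 2)
        (four (by omega)) (t_comm (by omega) (by omega)) (braid (le_refl 1) (by omega))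
      simpa [mul_assoc] using this
    | loop_comm i hi h =>
      have e1 := t_comm (n := n + 1) (i := i + 1) (by omega) (by omega)
      have e2 := far (n := n + 1) (i := 1) (j := i + 1) (le_refl 1) (by omega) (by omega)
      simp only [map_mul, FreeGroup.lift_apply_of]
      rw [mul_assoc, e2, mul_assoc, ← mul_assoc (t (n + 1)), e1, mul_assoc, ← mul_assoc, e2,
        mul_assoc, mul_assoc]
    | braid i hi hj => simpa using braid (n := n + 1) (i := i + 1) (by omega) (by omega)
    | far i j hi hj h =>
      simpa using far (n := n + 1) (i := i + 1) (j := j + 1) (by omega) (by omega) (by omega))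

/-- The exponent sum of the `σ_i` in a braid (`t` counts `0`). -/
def expSum (n : ℕ) : BraidB n →* Multiplicative ℤ :=
  lift (fun
    | .t => 1
    | .sigma _ _ => Multiplicative.ofAdd 1) (by
    intro x y h
    cases h <;> simp)

/-- The monomial `t_0^{k_0} t_1^{k_1} ⋯ t_{m-1}^{k_{m-1}}`. -/
def monomial (n m : ℕ) (k : ℕ → ℤ) : BraidB n :=
  ((List.range m).map fun i => loop n i ^ k i).prod

/-- Braiding tails: the words of Jones' normal form basis of the Hecke algebra `H_n(q)` of type A,
i.e. the products over `i = 1, …, n - 1`, in this order, of blocks `σ_i σ_{i-1} ⋯ σ_{i-d_i+1}` with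
`0 ≤ d_i ≤ i`. A block of length `d_i = 0` is a block that is omitted. -/
def tails (n : ℕ) : Set (BraidB n) :=
  {w | ∃ d : ℕ → ℕ, (∀ i, d i ≤ i) ∧ w = ((List.range n).map fun i => desc n i (d i)).prod}

/-- `Σ_n`: monomials in `t_0, …, t_{n-1}` with arbitrary integer exponents (exponent `0` being
a gap), followed by a braiding tail. -/
def sigmaSet (n : ℕ) : Set (BraidB n) :=
  {α | ∃ (k : ℕ → ℤ), ∃ w ∈ tails n, α = monomial n n k * w}

/-- Elements of `L`, i.e. monomials `t_0^{k_0} ⋯ t_m^{k_m}` with all exponents nonzero (no gaps),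
in `B_{1,n}`, `n ≥ m + 1`, followed by a braiding tail. -/
def lSet (n : ℕ) : Set (BraidB n) :=
  {β | ∃ (m : ℕ) (k : ℕ → ℤ), m + 1 ≤ n ∧ (∀ i ≤ m, k i ≠ 0) ∧
    ∃ w ∈ tails n, β = monomial n (m + 1) k * w}

/-- The positive (`ε = 1`) or negative (`ε = -1`) braid band move with framing `p` on the first
moving strand: `sl_{±1}(α) = t^p σ_1^{±1} α₊`. -/
def slFirst (p : ℤ) (ε : ℤˣ) {n : ℕ} (α : BraidB n) : BraidB (n + 1) :=
  t (n + 1) ^ p * sigma (n + 1) 1 ^ (ε : ℤ) * shift n α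

/-- The braid band move on the `i`-th moving strand, `1 ≤ i ≤ n`: the `i`-th strand is first brought
to the first place by conjugation,
`sl_{±i}(β) = sl_{±1}((σ_1⁻¹ ⋯ σ_{i-1}⁻¹) β (σ_{i-1} ⋯ σ_1))`. -/
def sl (p : ℤ) (ε : ℤˣ) {n : ℕ} (i : ℕ) (β : BraidB n) : BraidB (n + 1) :=
  slFirst p ε ((desc n (i - 1) (i - 1))⁻¹ * β * desc n (i - 1) (i - 1))

end BraidB

/-! ### The generalized Iwahori–Hecke algebras of type B -/

section Hecke

variable (K : Type*) [CommRing K]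

/-- The quadratic relations `σ_i² = (q - 1) σ_i + q`. -/
inductive HeckeRel (q : Kˣ) (n : ℕ) :
    MonoidAlgebra K (BraidB n) → MonoidAlgebra K (BraidB n) → Prop
  | quad (i : ℕ) (hi : 1 ≤ i ∧ i < n) :
      HeckeRel q n
        (MonoidAlgebra.of K (BraidB n) (BraidB.sigma n i) ^ 2)
        (((q : K) - 1) • MonoidAlgebra.of K (BraidB n) (BraidB.sigma n i) + (q : K) • 1)

/-- `H_{1,n}(q)`: the quotient of the group algebra of `B_{1,n}` by the quadratic relations. -/
def HeckeB (q : Kˣ) (n : ℕ) : Type _ := RingQuot (HeckeRel K q n)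

noncomputable instance HeckeB.instRing (q : Kˣ) (n : ℕ) : Ring (HeckeB K q n) :=
  inferInstanceAs (Ring (RingQuot (HeckeRel K q n)))

noncomputable instance HeckeB.instAlgebra (q : Kˣ) (n : ℕ) : Algebra K (HeckeB K q n) :=
  inferInstanceAs (Algebra K (RingQuot (HeckeRel K q n)))

variable {K}

/-- The quotient map from the group algebra of `B_{1,n}` to `H_{1,n}(q)`. -/
noncomputable def HeckeB.mk (q : Kˣ) (n : ℕ) : MonoidAlgebra K (BraidB n) →ₐ[K] HeckeB K q n :=
  RingQuot.mkAlgHom K (HeckeRel K q n)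

/-- The canonical map `π : B_{1,n} → H_{1,n}(q)`. -/
noncomputable def HeckeB.ofBraid (q : Kˣ) (n : ℕ) : BraidB n →* HeckeB K q n :=
  (HeckeB.mk q n).toMonoidHom.comp (MonoidAlgebra.of K (BraidB n))

theorem HeckeB.ofBraid_sq (q : Kˣ) {n i : ℕ} (hi : 1 ≤ i ∧ i < n) :
    HeckeB.ofBraid q n (BraidB.sigma n i) ^ 2 =
      ((q : K) - 1) • HeckeB.ofBraid q n (BraidB.sigma n i) + (q : K) • 1 := by
  have h : HeckeB.mk q n _ = HeckeB.mk q n _ :=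
    RingQuot.mkAlgHom_rel K (HeckeRel.quad (K := K) (q := q) i hi)
  simp only [map_pow, map_add, map_smul, map_one] at h
  exact h

/-- The homomorphism out of `H_{1,n}(q)` induced by a homomorphism out of the group algebra that
respects the quadratic relations. -/
noncomputable def HeckeB.lift (q : Kˣ) (n : ℕ) {A : Type*} [Semiring A] [Algebra K A]
    (f : MonoidAlgebra K (BraidB n) →ₐ[K] A) (hf : ∀ ⦃x y⦄, HeckeRel K q n x y → f x = f y) :
    HeckeB K q n →ₐ[K] A :=
  RingQuot.liftAlgHom K ⟨f, hf⟩

theorem HeckeB.lift_mk (q : Kˣ) (n : ℕ) {A : Type*} [Semiring A] [Algebra K A]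
    (f : MonoidAlgebra K (BraidB n) →ₐ[K] A) (hf : ∀ ⦃x y⦄, HeckeRel K q n x y → f x = f y)
    (x : MonoidAlgebra K (BraidB n)) : HeckeB.lift q n f hf (HeckeB.mk q n x) = f x :=
  RingQuot.liftAlgHom_mkAlgHom_apply K f hf x

theorem BraidB.incl_sigma {n i : ℕ} (hi : 1 ≤ i ∧ i < n) :
    BraidB.incl n (BraidB.sigma n i) = BraidB.sigma (n + 1) i := by
  rw [BraidB.sigma_of hi]
  simp [BraidB.incl, BraidB.lift]

/-- The natural map `H_{1,n}(q) → H_{1,n+1}(q)`. -/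
noncomputable def HeckeB.incl (q : Kˣ) (n : ℕ) : HeckeB K q n →ₐ[K] HeckeB K q (n + 1) :=
  HeckeB.lift q n
    (MonoidAlgebra.lift K (HeckeB K q (n + 1)) (BraidB n)
      ((HeckeB.ofBraid q (n + 1)).comp (BraidB.incl n))) (by
      rintro x y ⟨i, hi⟩
      have h := HeckeB.ofBraid_sq q (n := n + 1) (i := i) ⟨hi.1, by omega⟩
      simp only [map_pow, map_add, map_smul, map_one, MonoidAlgebra.lift_of, MonoidHom.comp_apply,
        BraidB.incl_sigma hi]
      exact h)

/-! ### The Markov trace and the invariant `X` -/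

/-- The ring of polynomials over `K` in the unknowns `s_k`, `k ∈ ℤ ∖ {0}`. -/
abbrev TraceRing (K : Type*) [CommRing K] : Type _ := MvPolynomial {k : ℤ // k ≠ 0} K

/-- A Markov trace on `⋃_{n ≥ 1} H_{1,n}(q)` with parameters `z` and `s_k`: a family of linear
functions compatible with `H_{1,n}(q) → H_{1,n+1}(q)` and satisfying the four trace rules. (Rule 4
with `k = 0` just says that `s_0` is `1`.) -/
structure IsMarkovTrace (q z : Kˣ) (tr : ∀ n : ℕ, HeckeB K q n →ₗ[K] TraceRing K) : Prop where
  incl : ∀ n, 1 ≤ n → ∀ a, tr (n + 1) (HeckeB.incl q n a) = tr n a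
  comm : ∀ n, 1 ≤ n → ∀ a b, tr n (a * b) = tr n (b * a)
  one : ∀ n, 1 ≤ n → tr n 1 = 1
  markov : ∀ n, 1 ≤ n → ∀ a,
    tr (n + 1) (HeckeB.incl q n a * HeckeB.ofBraid q (n + 1) (BraidB.sigma (n + 1) n)) =
      (z : K) • tr n a
  loop : ∀ n, 1 ≤ n → ∀ a, ∀ k : {k : ℤ // k ≠ 0},
    tr (n + 1) (HeckeB.incl q n a *
      HeckeB.ofBraid q (n + 1) (BraidB.loop' (n + 1) n ^ (k : ℤ))) = MvPolynomial.X k * tr n a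

open Classical in
/-- Lambropoulou's trace: the Markov trace on `⋃_n H_{1,n}(q)` with parameters `z` and `s_k`. It
exists and is unique on `n ≥ 1`. -/
noncomputable def markovTrace (q z : Kˣ) : ∀ n : ℕ, HeckeB K q n →ₗ[K] TraceRing K :=
  if h : ∃ tr, IsMarkovTrace q z tr then h.choose else fun _ => 0

/-- The normalization `-(1 - λ q) / (√λ (1 - q))` of the invariant `X`. As
`λ = (z + 1 - q) / (q z)`, it is equal to `1 / (z √λ)`, see `normFactor_spec`; the latter form makes
sense whenever `z` and `√λ` are units. Here `r` stands for `√λ`. -/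
def normFactor (z r : Kˣ) : Kˣ := (z * r)⁻¹

theorem normFactor_spec (q z r : Kˣ) (hr : (r : K) ^ 2 * (q * z) = z + 1 - q) :
    (normFactor z r : K) * (r * (1 - q)) = -(1 - (r : K) ^ 2 * q) := by
  have h1 : (normFactor z r : K) * ((z : K) * r) = 1 := by
    simpa [normFactor] using Units.inv_mul (z * r)
  have hz : (z : K) * ((normFactor z r : K) * (r * (1 - q)) + (1 - (r : K) ^ 2 * q)) = 0 := by
    linear_combination (1 - (q : K)) * h1 - hr
  have := (Units.mul_right_eq_zero z).mp hz
  linear_combination this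

/-- Lambropoulou's invariant of the closure of `α ∈ B_{1,n}`:
`X = [-(1 - λ q) / (√λ (1 - q))]^{n-1} (√λ)^e tr(π(α))`, with `r = √λ`. -/
noncomputable def invX (q z r : Kˣ) (n : ℕ) (α : BraidB n) : TraceRing K :=
  ((normFactor z r ^ (n - 1) * r ^ (Multiplicative.toAdd (BraidB.expSum n α)) : Kˣ) : K) •
    markovTrace q z n (HeckeB.ofBraid q n α)

/-! ### The two infinite systems -/

/-- The equations `X(α) = X(sl_{±1}(α))`, `α ∈ Σ = ⋃_{n ≥ 1} Σ_n`, as pairs of left and right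
hand sides. -/
def sigmaSystem (q z r : Kˣ) (p : ℤ) : Set (TraceRing K × TraceRing K) :=
  {e | ∃ n : ℕ, 1 ≤ n ∧ ∃ α ∈ BraidB.sigmaSet n, ∃ ε : ℤˣ,
    e = (invX q z r n α, invX q z r (n + 1) (BraidB.slFirst p ε α))}

/-- The equations `X(β) = X(sl_{±i}(β))`, `β ∈ B_{1,n}` an element of `L` followed by a braiding
tail, `1 ≤ i ≤ n`. -/
def lSystem (q z r : Kˣ) (p : ℤ) : Set (TraceRing K × TraceRing K) :=
  {e | ∃ n : ℕ, 1 ≤ n ∧ ∃ β ∈ BraidB.lSet n, ∃ ε : ℤˣ, ∃ i : ℕ, 1 ≤ i ∧ i ≤ n ∧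
    e = (invX q z r n β, invX q z r (n + 1) (BraidB.sl p ε i β))}

/-- The `K`-module of all linear consequences of a system of equations. -/
noncomputable def consequences (S : Set (TraceRing K × TraceRing K)) : Submodule K (TraceRing K) :=
  Submodule.span K ((fun e => e.1 - e.2) '' S)

/-- `s` is a solution of the system `S`. -/
def IsSolution {A : Type*} [CommRing A] [Algebra K A] (S : Set (TraceRing K × TraceRing K))
    (s : {k : ℤ // k ≠ 0} → A) : Prop :=
  ∀ e ∈ S, MvPolynomial.aeval s e.1 = MvPolynomial.aeval s e.2

end Hecke

/-! Rescaled by powers of `r`, the braid shift becomes an algebra map `H_{1,n}(q) → H_{1,n+1}(q)`.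
Hence, up to a unit, `X(α) - X(sl_{±1}(α))` is the value at the image of `α` of a linear functional
`bandDiff` (`invX_sub_invX_slFirst`), and each system says that certain elements lie in a submodule
`bandSubmodule` of the Hecke algebra.

That (1) implies (2) is then a spanning statement: monomials with tails span `H_{1,n}(q)`
(`span_sigmaSet`), so (1) yields the first-strand equation for every element, in particular for the
conjugates that define the moves on the other strands; `X` itself does not see conjugation.

For the converse, `bandDiff (h * x) = bandDiff (x * h)` whenever `h` is `t` or a `g_j` with `j > 1`,
as the shifted `h` can be carried around the trace. The finite Hecke algebra is spanned by products
of such `g_j` followed by some `(σ_i ⋯ σ_1)⁻¹` (`genSubalgebra_le_span`), and these last factors are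
exactly the conjugators of the moves on strand `i + 1`. So (2) controls `a τ b` for `τ` without gaps
and arbitrary braiding `a`, `b`. The exchange rule for `y = g x g` then fills gaps
(`monomial_mem_of_gapfree`), which settles all nontrivial monomials.

Pure braiding, the trivial monomial, remains. Since `σ_1⁻¹ = t⁻¹ (t_0 t_1⁻¹ σ_1) t` and `t` slides,
elements `h σ_1⁻¹` are covered by the nontrivial case. Destabilizing `σ_1⁻¹` on two strands gives
the equation for `1`, and Markov stabilization with further sliding gives the rest
(`genSubalgebra_le_bandSubmodule`). -/

namespace BraidB

/-! ### Commutation rules and structure maps of the braid groups. -/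

variable {n : ℕ}

theorem sigma_zero : sigma n 0 = 1 := by simp [sigma]

theorem sigma_of_le {i : ℕ} (h : n ≤ i) : sigma n i = 1 := by
  simp [sigma, Nat.not_lt.mpr h]

/-- No range condition is needed, because crossings outside the range are `1` by default. -/
theorem commute_sigma {i j : ℕ} (h : i + 1 < j) : Commute (sigma n i) (sigma n j) := by
  rcases Nat.eq_zero_or_pos i with rfl | hi
  · rw [sigma_zero]; exact Commute.one_left _
  rcases le_or_gt n j with hj | hj
  · rw [sigma_of_le hj]; exact Commute.one_right _
  exact far hi h hj

theorem commute_t_sigma {i : ℕ} (h : 1 < i) : Commute (t n) (sigma n i) := by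
  rcases le_or_gt n i with hj | hj
  · rw [sigma_of_le hj]; exact Commute.one_right _
  exact t_comm h hj

theorem loop_zero : loop n 0 = t n := rfl

theorem loop_succ (i : ℕ) : loop n (i + 1) = sigma n (i + 1) * loop n i * sigma n (i + 1) := rfl

theorem commute_loop_sigma_of_lt {i j : ℕ} (h : i + 1 < j) :
    Commute (loop n i) (sigma n j) := by
  induction i with
  | zero => exact commute_t_sigma h
  | succ i ih =>
    rw [loop_succ]
    have := commute_sigma (n := n) h
    exact (this.mul_left (ih (by omega))).mul_left this

/-- The case that matters is `i = j + 1`: in `σ_{j+1} σ_j t_{j-1} σ_j σ_{j+1}` a braid relation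
carries `σ_j` in from the right as `σ_{j+1}`, which passes `t_{j-1}` and leaves on the left as
`σ_j`. -/
theorem commute_loop_sigma_of_gt {i j : ℕ} (hj : 1 ≤ j) (h : j < i) (hi : i < n) :
    Commute (loop n i) (sigma n j) := by
  induction i with
  | zero => omega
  | succ i ih =>
    rcases Nat.lt_or_ge j i with hji | hji
    · have := (commute_sigma (n := n) (i := j) (j := i + 1) (by omega)).symm
      rw [loop_succ]
      exact (this.mul_left (ih hji (by omega))).mul_left this
    · obtain rfl : j = i := by omega
      obtain ⟨m, rfl⟩ : ∃ m, j = m + 1 := ⟨j - 1, by omega⟩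
      have hb := braid (n := n) (i := m + 1) (by omega) hi
      have hc := (commute_loop_sigma_of_lt (n := n) (i := m) (j := m + 2) (by omega)).eq
      rw [loop_succ, loop_succ]
      change _ * _ = _ * _
      calc sigma n (m + 1 + 1) * (sigma n (m + 1) * loop n m * sigma n (m + 1)) *
            sigma n (m + 1 + 1) * sigma n (m + 1)
          = sigma n (m + 1 + 1) * sigma n (m + 1) * loop n m *
            (sigma n (m + 1) * sigma n (m + 1 + 1) * sigma n (m + 1)) := by group
        _ = sigma n (m + 1 + 1) * sigma n (m + 1) * (loop n m * sigma n (m + 1 + 1)) *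
            sigma n (m + 1) * sigma n (m + 1 + 1) := by rw [hb]; group
        _ = (sigma n (m + 1 + 1) * sigma n (m + 1) * sigma n (m + 1 + 1)) * loop n m *
            sigma n (m + 1) * sigma n (m + 1 + 1) := by rw [hc]; group
        _ = _ := by rw [← hb]; group

/-- For neighbours `t_{m+1}`, `t_{m+2}`, each factor of `σ_{m+1} t_m σ_{m+1}` commutes with
`t_{m+2}`; the pair `t_0`, `t_1` is the four-term relation. -/
theorem commute_loop_of_lt {i j : ℕ} (h : i < j) (hj : j < n) :
    Commute (loop n i) (loop n j) := by
  induction j generalizing i with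
  | zero => omega
  | succ j ih =>
    rcases Nat.lt_or_ge i j with hij | hij
    · have := commute_loop_sigma_of_lt (n := n) (i := i) (j := j + 1) (by omega)
      rw [loop_succ]
      exact (this.mul_right (ih hij (by omega))).mul_right this
    · obtain rfl : i = j := by omega
      cases i with
      | zero =>
        have := four (n := n) hj
        rw [loop_succ, loop_zero]
        change _ * _ = _ * _
        simp only [zero_add, ← mul_assoc]
        exact this.symm
      | succ m =>
        have h1 := (commute_loop_sigma_of_gt (n := n) (i := m + 2) (j := m + 1) (by omega)
          (by omega) hj).symm
        have h2 : Commute (loop n m) (loop n (m + 2)) := by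
          have := commute_loop_sigma_of_lt (n := n) (i := m) (j := m + 2) (by omega)
          rw [loop_succ (m + 1)]
          exact (this.mul_right (ih (by omega) (by omega))).mul_right this
        rw [loop_succ m]
        exact (h1.mul_left h2).mul_left h1

theorem commute_loop {i j : ℕ} (hi : i < n) (hj : j < n) : Commute (loop n i) (loop n j) := by
  rcases lt_trichotomy i j with h | rfl | h
  · exact commute_loop_of_lt h hj
  · exact Commute.refl _
  · exact (commute_loop_of_lt h hi).symm

/-! Monomials in the loop elements. -/

theorem monomial_succ (m : ℕ) (k : ℕ → ℤ) :
    monomial n (m + 1) k = monomial n m k * loop n m ^ k m := by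
  simp [monomial, List.range_succ]

theorem commute_monomial {m : ℕ} {k : ℕ → ℤ} {x : BraidB n}
    (h : ∀ i < m, k i ≠ 0 → Commute (loop n i) x) : Commute (monomial n m k) x := by
  induction m with
  | zero => simp [monomial]
  | succ m ih =>
    rw [monomial_succ]
    refine (ih fun i hi => h i (by omega)).mul_left ?_
    by_cases hk : k m = 0
    · simp [hk]
    · exact (h m (by omega) hk).zpow_left _

theorem monomial_add {m : ℕ} (hm : m ≤ n) (k l : ℕ → ℤ) :
    monomial n m (k + l) = monomial n m k * monomial n m l := by
  induction m with
  | zero => simp [monomial]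
  | succ m ih =>
    have hc : Commute (monomial n m l) (loop n m ^ k m) :=
      commute_monomial fun i hi _ => (commute_loop (by omega) (by omega)).zpow_right _
    rw [monomial_succ, monomial_succ, monomial_succ, ih (by omega), Pi.add_apply, zpow_add,
      mul_assoc, mul_assoc, ← mul_assoc (monomial n m l), hc.eq]
    simp only [mul_assoc]

theorem monomial_congr {m : ℕ} {k l : ℕ → ℤ} (h : ∀ i < m, k i = l i) :
    monomial n m k = monomial n m l := by
  induction m with
  | zero => simp [monomial]
  | succ m ih => rw [monomial_succ, monomial_succ, ih fun i hi => h i (by omega), h m (by omega)]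

theorem monomial_zero (m : ℕ) : monomial n m 0 = 1 := by
  induction m with
  | zero => simp [monomial]
  | succ m ih => simp [monomial_succ, ih]

theorem monomial_single {m j : ℕ} (hj : j < m) (a : ℤ) :
    monomial n m (Pi.single j a) = loop n j ^ a := by
  induction m with
  | zero => omega
  | succ m ih =>
    rw [monomial_succ]
    rcases Nat.lt_or_ge j m with h | h
    · rw [ih h, Pi.single_eq_of_ne (by omega)]; simp
    · obtain rfl : j = m := by omega
      rw [Pi.single_eq_same, monomial_congr (l := 0), monomial_zero, one_mul]
      intro i hi
      rw [Pi.single_eq_of_ne (by omega)]; rfl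

theorem monomial_eq_of_le {m m' : ℕ} (h : m ≤ m') {k : ℕ → ℤ} (hk : ∀ i, m ≤ i → k i = 0) :
    monomial n m' k = monomial n m k := by
  induction m', h using Nat.le_induction with
  | base => rfl
  | succ m' hm ih => rw [monomial_succ, ih, hk m' hm]; simp

/-- Splitting off the exponents at `j` and `j + 1`. -/
theorem monomial_eq {j : ℕ} (hj : j + 1 < n) (k : ℕ → ℤ) :
    monomial n n k = monomial n n (Function.update (Function.update k j 0) (j + 1) 0) *
      (loop n j ^ k j * loop n (j + 1) ^ k (j + 1)) := by
  rw [← monomial_single (show j < n by omega), ← monomial_single hj, ← monomial_add le_rfl,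
    ← monomial_add le_rfl]
  congr 1
  funext i
  by_cases h1 : i = j + 1
  · subst h1; simp
  · by_cases h2 : i = j
    · subst h2; simp
    · simp [h1, h2]

theorem commute_monomial_sigma {j : ℕ} {k : ℕ → ℤ} (h0 : k j = 0)
    (h1 : k (j + 1) = 0) : Commute (monomial n n k) (sigma n (j + 1)) := by
  refine commute_monomial fun i hi hk => ?_
  have : i ≠ j := fun h => hk (h ▸ h0)
  have : i ≠ j + 1 := fun h => hk (h ▸ h1)
  rcases Nat.lt_or_ge i j with h | h
  · exact commute_loop_sigma_of_lt (by omega)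
  · exact commute_loop_sigma_of_gt (by omega) (by omega) hi

/-! Descending blocks. -/

theorem desc_zero (i : ℕ) : desc n i 0 = 1 := by simp [desc]

theorem desc_succ (i d : ℕ) : desc n i (d + 1) = desc n i d * sigma n (i - d) := by
  simp [desc, List.range_succ]

theorem desc_succ' (i d : ℕ) : desc n (i + 1) (d + 1) = sigma n (i + 1) * desc n i d := by
  induction d with
  | zero => simp [desc_succ, desc_zero]
  | succ d ih => rw [desc_succ, ih, desc_succ, mul_assoc]; congr 3; omega

theorem commute_desc_sigma_of_lt {i d j : ℕ} (h : j + d < i) :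
    Commute (desc n i d) (sigma n j) := by
  induction d with
  | zero => rw [desc_zero]; exact Commute.one_left _
  | succ d ih =>
    rw [desc_succ]
    exact (ih (by omega)).mul_left (commute_sigma (by omega)).symm

theorem commute_desc_sigma_of_gt {i d j : ℕ} (h : i + 1 < j) :
    Commute (desc n i d) (sigma n j) := by
  induction d with
  | zero => rw [desc_zero]; exact Commute.one_left _
  | succ d ih =>
    rw [desc_succ]
    exact ih.mul_left (commute_sigma (by omega))

/-- A descending block lowers the index of a crossing. -/
theorem desc_mul_sigma {i d j : ℕ} (hi : i < n) (hd : d ≤ i) (h1 : i + 1 < j + 1 + d)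
    (h2 : j + 1 ≤ i) (hj : 1 ≤ j) :
    desc n i d * sigma n (j + 1) = sigma n j * desc n i d := by
  induction d with
  | zero => omega
  | succ d ih =>
    rcases Nat.lt_or_ge (i + 1) (j + 1 + d) with h | h
    · rw [desc_succ, mul_assoc, (commute_sigma (n := n) (i := i - d) (j := j + 1) (by omega)).eq,
        ← mul_assoc, ih (by omega) h, mul_assoc]
    · obtain ⟨d, rfl⟩ : ∃ e, d = e + 1 := ⟨d - 1, by omega⟩
      have e1 : i - d = j + 1 := by omega
      have e2 : i - (d + 1) = j := by omega
      rw [desc_succ, desc_succ, e1, e2, mul_assoc, mul_assoc,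
        ← mul_assoc (sigma n (j + 1)) (sigma n j), ← braid hj (by omega), ← mul_assoc, ← mul_assoc,
        (commute_desc_sigma_of_lt (n := n) (i := i) (d := d) (j := j) (by omega)).eq]
      simp only [mul_assoc]

/-! Images of the structure maps. -/

theorem lift_t {G : Type*} [Group G] (f : BraidGen n → G) (hf) : lift f hf (t n) = f .t := by
  simp [lift, t]

theorem lift_sigma {G : Type*} [Group G] (f : BraidGen n → G) (hf) {i : ℕ} (hi : 1 ≤ i ∧ i < n) :
    lift f hf (sigma n i) = f (.sigma i hi) := by
  simp [lift, sigma_of hi]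

theorem incl_t : incl n (t n) = t (n + 1) := lift_t _ _

theorem shift_t : shift n (t n) = sigma (n + 1) 1 * t (n + 1) * sigma (n + 1) 1 := lift_t _ _

theorem shift_sigma {i : ℕ} (hi : 1 ≤ i ∧ i < n) : shift n (sigma n i) = sigma (n + 1) (i + 1) :=
  lift_sigma _ _ hi

theorem expSum_t : expSum n (t n) = 1 := lift_t _ _

theorem expSum_sigma {i : ℕ} (hi : 1 ≤ i ∧ i < n) :
    expSum n (sigma n i) = Multiplicative.ofAdd 1 := lift_sigma _ _ hi

/-- Induction over products of generators and their inverses. -/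
theorem induction_on {P : BraidB n → Prop} (b : BraidB n) (one : P 1)
    (t_mul : ∀ x, P x → P (t n * x)) (t_inv_mul : ∀ x, P x → P ((t n)⁻¹ * x))
    (sigma_mul : ∀ i, 1 ≤ i ∧ i < n → ∀ x, P x → P (sigma n i * x))
    (sigma_inv_mul : ∀ i, 1 ≤ i ∧ i < n → ∀ x, P x → P ((sigma n i)⁻¹ * x)) : P b := by
  have hb : b ∈ Subgroup.closure (Set.range (PresentedGroup.of (rels :=
      {r : FreeGroup (BraidGen n) | ∃ x y, BraidRel n x y ∧ r = x * y⁻¹}))) := by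
    rw [PresentedGroup.closure_range_of]; trivial
  induction hb using Subgroup.closure_induction_left with
  | one => exact one
  | mul_left x hx y hy ih =>
    obtain ⟨g, rfl⟩ := hx
    cases g with
    | t => exact t_mul _ ih
    | sigma i hi => rw [← sigma_of hi]; exact sigma_mul i hi _ ih
  | inv_mul_cancel x hx y hy ih =>
    obtain ⟨g, rfl⟩ := hx
    cases g with
    | t => exact t_inv_mul _ ih
    | sigma i hi => rw [← sigma_of hi]; exact sigma_inv_mul i hi _ ih

theorem hom_ext {M : Type*} [Monoid M] {f g : BraidB n →* M} (ht : f (t n) = g (t n))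
    (hs : ∀ i, 1 ≤ i ∧ i < n → f (sigma n i) = g (sigma n i)) : f = g := by
  have key : ∀ x, f x = g x → f x⁻¹ = g x⁻¹ := fun x hx => by
    refine left_inv_eq_right_inv (a := f x) ?_ ?_
    · rw [← map_mul, inv_mul_cancel, map_one]
    · rw [hx, ← map_mul, mul_inv_cancel, map_one]
  ext b
  induction b using induction_on with
  | one => simp
  | t_mul x h => rw [map_mul, map_mul, h, ht]
  | t_inv_mul x h => rw [map_mul, map_mul, h, key _ ht]
  | sigma_mul i hi x h => rw [map_mul, map_mul, h, hs i hi]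
  | sigma_inv_mul i hi x h => rw [map_mul, map_mul, h, key _ (hs i hi)]

theorem shift_incl (hn : 1 ≤ n) (b : BraidB n) :
    shift (n + 1) (incl n b) = incl (n + 1) (shift n b) := by
  have : (shift (n + 1)).comp (incl n) = (incl (n + 1)).comp (shift n) := by
    refine hom_ext ?_ fun i hi => ?_
    · simp only [MonoidHom.comp_apply]
      rw [incl_t, shift_t, shift_t, map_mul, map_mul, incl_t, incl_sigma (by omega)]
    · simp only [MonoidHom.comp_apply]
      rw [incl_sigma hi, shift_sigma (by omega), shift_sigma hi, incl_sigma (by omega)]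
  exact DFunLike.congr_fun this b

theorem expSum_incl (b : BraidB n) : expSum (n + 1) (incl n b) = expSum n b := by
  have : (expSum (n + 1)).comp (incl n) = expSum n := by
    refine hom_ext ?_ fun i hi => ?_
    · simp only [MonoidHom.comp_apply]
      rw [incl_t, expSum_t, expSum_t]
    · simp only [MonoidHom.comp_apply]
      rw [incl_sigma hi, expSum_sigma hi, expSum_sigma (by omega)]
  exact DFunLike.congr_fun this b

/-- The shifted generators are `t_1` and the `σ_i` with `i > 1`, and `t` commutes with all of them.
-/
theorem commute_t_shift (b : BraidB n) : Commute (t (n + 1)) (shift n b) := by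
  have ht : Commute (t (n + 1)) (shift n (t n)) := by
    rw [shift_t]
    rcases Nat.eq_zero_or_pos n with rfl | hn
    · simp [sigma, Commute.refl]
    · exact commute_loop (n := n + 1) (i := 0) (j := 1) (by omega) (by omega)
  have hs : ∀ i, 1 ≤ i ∧ i < n → Commute (t (n + 1)) (shift n (sigma n i)) := fun i hi => by
    rw [shift_sigma hi]; exact commute_t_sigma (by omega)
  induction b using induction_on with
  | one => rw [map_one]; exact Commute.one_right _
  | t_mul x h => rw [map_mul]; exact ht.mul_right h
  | t_inv_mul x h => rw [map_mul, map_inv]; exact ht.inv_right.mul_right h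
  | sigma_mul i hi x h => rw [map_mul]; exact (hs i hi).mul_right h
  | sigma_inv_mul i hi x h => rw [map_mul, map_inv]; exact (hs i hi).inv_right.mul_right h

theorem incl_desc {i d : ℕ} (hi : i < n) (hd : d ≤ i) :
    incl n (desc n i d) = desc (n + 1) i d := by
  induction d with
  | zero => simp [desc_zero]
  | succ d ih => rw [desc_succ, desc_succ, map_mul, ih (by omega), incl_sigma (by omega)]

end BraidB

section MarkovTrace

variable {K : Type*} [CommRing K]

/-! Traces. -/

/-- In the default branch `markovTrace` is `0`, where this rule and the next two are trivial, so the
existence of the trace plays no role. -/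
theorem markovTrace_comm (q z : Kˣ) {n : ℕ} (hn : 1 ≤ n) (a b : HeckeB K q n) :
    markovTrace q z n (a * b) = markovTrace q z n (b * a) := by
  unfold markovTrace
  split_ifs with h
  · exact h.choose_spec.comm n hn a b
  · rfl

theorem markovTrace_incl (q z : Kˣ) {n : ℕ} (hn : 1 ≤ n) (a : HeckeB K q n) :
    markovTrace q z (n + 1) (HeckeB.incl q n a) = markovTrace q z n a := by
  unfold markovTrace
  split_ifs with h
  · exact h.choose_spec.incl n hn a
  · rfl

theorem markovTrace_markov (q z : Kˣ) {n : ℕ} (hn : 1 ≤ n) (a : HeckeB K q n) :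
    markovTrace q z (n + 1)
      (HeckeB.incl q n a * HeckeB.ofBraid q (n + 1) (BraidB.sigma (n + 1) n)) =
      (z : K) • markovTrace q z n a := by
  unfold markovTrace
  split_ifs with h
  · exact h.choose_spec.markov n hn a
  · simp

end MarkovTrace

/-! ### The difference of the two sides as a linear functional, and its trace properties. -/

namespace HeckeB

open BraidB (sigma t)

variable {K : Type*} [CommRing K] (q z r : Kˣ) {n : ℕ}

theorem induction_on {P : HeckeB K q n → Prop} (x : HeckeB K q n)
    (ofBraid : ∀ b, P (ofBraid q n b)) (add : ∀ x y, P x → P y → P (x + y))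
    (smul : ∀ (c : K) x, P x → P (c • x)) : P x := by
  obtain ⟨y, rfl⟩ : ∃ y, mk q n y = x := RingQuot.mkAlgHom_surjective K (HeckeRel K q n) x
  induction y using MonoidAlgebra.induction_on with
  | of b => exact ofBraid b
  | add x y hx hy => rw [map_add]; exact add _ _ hx hy
  | smul c x hx => rw [map_smul]; exact smul _ _ hx

theorem lift_ofBraid {A : Type*} [Semiring A] [Algebra K A]
    (f : MonoidAlgebra K (BraidB n) →ₐ[K] A) (hf) (b : BraidB n) :
    lift q n f hf (ofBraid q n b) = f (MonoidAlgebra.of K _ b) :=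
  lift_mk q n f hf _

theorem incl_ofBraid (b : BraidB n) :
    incl q n (ofBraid q n b) = ofBraid q (n + 1) (BraidB.incl n b) := by
  rw [incl, lift_ofBraid, MonoidAlgebra.lift_of]; rfl

/-- The image of `σ_i`. -/
noncomputable def gen (n i : ℕ) : HeckeB K q n := ofBraid q n (sigma n i)

theorem gen_mul_self {i : ℕ} (hi : 1 ≤ i ∧ i < n) :
    gen q n i * gen q n i = ((q : K) - 1) • gen q n i + (q : K) • 1 := by
  rw [← pow_two]; exact ofBraid_sq q hi

theorem ofBraid_mul_inv (b : BraidB n) : ofBraid q n b * ofBraid q n b⁻¹ = 1 := by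
  rw [← map_mul, mul_inv_cancel, map_one]

theorem ofBraid_inv_mul (b : BraidB n) : ofBraid q n b⁻¹ * ofBraid q n b = 1 := by
  rw [← map_mul, inv_mul_cancel, map_one]

theorem ofBraid_sigma_inv {i : ℕ} (hi : 1 ≤ i ∧ i < n) :
    ofBraid q n (sigma n i)⁻¹ =
      (↑q⁻¹ : K) • gen q n i + ((↑q⁻¹ : K) - 1) • 1 := by
  refine left_inv_eq_right_inv (ofBraid_inv_mul q (sigma n i)) ?_
  have h := gen_mul_self q hi
  have hq : (↑q⁻¹ : K) * q = 1 := Units.inv_mul q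
  change gen q n i * _ = 1
  rw [mul_add, mul_smul_comm, mul_smul_comm, h, mul_one, smul_add, smul_smul, smul_smul,
    mul_sub, mul_one, hq, one_smul, add_right_comm, ← add_smul]
  simp

theorem gen_eq {i : ℕ} (hi : 1 ≤ i ∧ i < n) :
    gen q n i = (q : K) • ofBraid q n (sigma n i)⁻¹ + ((q : K) - 1) • 1 := by
  have hq : (q : K) * (↑q⁻¹ : K) = 1 := Units.mul_inv q
  rw [ofBraid_sigma_inv q hi, smul_add, smul_smul, smul_smul, mul_sub, mul_one, hq, one_smul,
    add_assoc, ← add_smul]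
  simp

/-- The scalar `r ^ (e(α₊) - e(α))`, a character of `B_{1,n}`. -/
noncomputable def shiftScalar (n : ℕ) : BraidB n →* Kˣ :=
  (zpowersHom Kˣ r).comp ((BraidB.expSum (n + 1)).comp (BraidB.shift n) / BraidB.expSum n)

theorem shiftScalar_eq (b : BraidB n) :
    shiftScalar r n b = r ^ (Multiplicative.toAdd (BraidB.expSum (n + 1) (BraidB.shift n b)) -
      Multiplicative.toAdd (BraidB.expSum n b)) := by
  rw [zpow_sub, ← div_eq_mul_inv]
  simp [shiftScalar]

theorem shiftScalar_sigma {i : ℕ} (hi : 1 ≤ i ∧ i < n) : shiftScalar r n (sigma n i) = 1 := by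
  rw [shiftScalar_eq, BraidB.shift_sigma hi, BraidB.expSum_sigma hi,
    BraidB.expSum_sigma (by omega)]
  simp

theorem shiftScalar_incl (hn : 1 ≤ n) (b : BraidB n) :
    shiftScalar r (n + 1) (BraidB.incl n b) = shiftScalar r n b := by
  rw [shiftScalar_eq, shiftScalar_eq, BraidB.shift_incl hn, BraidB.expSum_incl,
    BraidB.expSum_incl]

/-- The braid shift, rescaled by the exponent sums, as a representation in `H_{1,n+1}(q)`. -/
noncomputable def shiftRep (n : ℕ) : BraidB n →* HeckeB K q (n + 1) where
  toFun b := (shiftScalar r n b : K) • ofBraid q (n + 1) (BraidB.shift n b)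
  map_one' := by simp
  map_mul' a b := by
    rw [map_mul, map_mul, map_mul, smul_mul_smul_comm, Units.val_mul]

theorem shiftRep_sigma {i : ℕ} (hi : 1 ≤ i ∧ i < n) :
    shiftRep q r n (sigma n i) = gen q (n + 1) (i + 1) := by
  change (shiftScalar r n _ : K) • ofBraid q (n + 1) _ = _
  rw [shiftScalar_sigma r hi, BraidB.shift_sigma hi, Units.val_one, one_smul]; rfl

/-- The algebra map `H_{1,n}(q) → H_{1,n+1}(q)` induced by the rescaled braid shift. -/
noncomputable def shift (n : ℕ) : HeckeB K q n →ₐ[K] HeckeB K q (n + 1) :=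
  lift q n (MonoidAlgebra.lift K (HeckeB K q (n + 1)) (BraidB n) (shiftRep q r n)) (by
    rintro x y ⟨i, hi⟩
    simp only [map_pow, map_add, map_smul, map_one, MonoidAlgebra.lift_of, shiftRep_sigma q r hi]
    exact ofBraid_sq q (n := n + 1) (i := i + 1) (by omega))

theorem shift_ofBraid (b : BraidB n) :
    shift q r n (ofBraid q n b) =
      (shiftScalar r n b : K) • ofBraid q (n + 1) (BraidB.shift n b) := by
  rw [shift, lift_ofBraid, MonoidAlgebra.lift_of]; rfl

theorem shift_incl (hn : 1 ≤ n) (x : HeckeB K q n) :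
    shift q r (n + 1) (incl q n x) = incl q (n + 1) (shift q r n x) := by
  induction x using induction_on with
  | ofBraid b =>
    rw [incl_ofBraid, shift_ofBraid, shift_ofBraid, map_smul, incl_ofBraid,
      shiftScalar_incl r hn, BraidB.shift_incl hn]
  | add x y hx hy => simp only [map_add, hx, hy]
  | smul c x hx => simp only [map_smul, hx]

theorem commute_t_shift (x : HeckeB K q n) :
    Commute (ofBraid q (n + 1) (t (n + 1))) (shift q r n x) := by
  induction x using induction_on with
  | ofBraid b =>
    rw [shift_ofBraid]
    exact ((BraidB.commute_t_shift b).map (ofBraid q (n + 1))).smul_right _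
  | add x y hx hy => rw [map_add]; exact hx.add_right hy
  | smul c x hx => rw [map_smul]; exact hx.smul_right _

/-- The difference `X(α) - X(sl_{±1}(α))`, up to the factor `r ^ e(α)`, as a linear function of
the image of `α` in `H_{1,n}(q)`. -/
noncomputable def bandDiff (p : ℤ) (ε : ℤˣ) (n : ℕ) : HeckeB K q n →ₗ[K] TraceRing K :=
  ((normFactor z r ^ (n - 1) : Kˣ) : K) • markovTrace q z n -
    ((normFactor z r ^ n * r ^ (ε : ℤ) : Kˣ) : K) •
      (markovTrace q z (n + 1) ∘ₗ
        LinearMap.mulLeft K (ofBraid q (n + 1) (t (n + 1) ^ p * sigma (n + 1) 1 ^ (ε : ℤ))) ∘ₗ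
          (shift q r n).toLinearMap)

theorem bandDiff_apply (p : ℤ) (ε : ℤˣ) (x : HeckeB K q n) :
    bandDiff q z r p ε n x = ((normFactor z r ^ (n - 1) : Kˣ) : K) • markovTrace q z n x -
      ((normFactor z r ^ n * r ^ (ε : ℤ) : Kˣ) : K) • markovTrace q z (n + 1)
        (ofBraid q (n + 1) (t (n + 1) ^ p * sigma (n + 1) 1 ^ (ε : ℤ)) * shift q r n x) := rfl

theorem expSum_slFirst (hn : 1 ≤ n) (p : ℤ) (ε : ℤˣ) (α : BraidB n) :
    Multiplicative.toAdd (BraidB.expSum (n + 1) (BraidB.slFirst p ε α)) =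
      ε + Multiplicative.toAdd (BraidB.expSum (n + 1) (BraidB.shift n α)) := by
  simp [BraidB.slFirst, BraidB.expSum_t,
    BraidB.expSum_sigma (n := n + 1) (i := 1) (by omega)]

/-- The factor `r ^ (e(α₊) - e(α))` built into `shift` absorbs the change of exponent sum, leaving a
unit that depends on `α` but does not affect membership in submodules. -/
theorem invX_sub_invX_slFirst (hn : 1 ≤ n) (p : ℤ) (ε : ℤˣ) (α : BraidB n) :
    invX q z r n α - invX q z r (n + 1) (BraidB.slFirst p ε α) =
      ((r ^ Multiplicative.toAdd (BraidB.expSum n α) : Kˣ) : K) •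
        bandDiff q z r p ε n (ofBraid q n α) := by
  rw [bandDiff_apply, invX, invX, expSum_slFirst hn, shift_ofBraid, mul_smul_comm, map_smul,
    ← map_mul, shiftScalar_eq, smul_sub]
  congr 1
  · rw [smul_smul, ← Units.val_mul, mul_comm]
  · rw [smul_smul, smul_smul, ← Units.val_mul, ← Units.val_mul, zpow_sub, zpow_add,
      Nat.add_sub_cancel]
    congr 2
    generalize r ^ (BraidB.expSum n α).toAdd = a
    generalize r ^ (BraidB.expSum (n + 1) (BraidB.shift n α)).toAdd = b
    rw [mul_comm b, mul_comm a, mul_assoc _ a, mul_inv_cancel_left, mul_assoc]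

theorem bandDiff_incl (hn : 1 ≤ n) (p : ℤ) (ε : ℤˣ) (x : HeckeB K q n) :
    bandDiff q z r p ε (n + 1) (incl q n x) = (normFactor z r : K) • bandDiff q z r p ε n x := by
  have h : ofBraid q (n + 2) (t (n + 2) ^ p * sigma (n + 2) 1 ^ (ε : ℤ)) =
      incl q (n + 1) (ofBraid q (n + 1) (t (n + 1) ^ p * sigma (n + 1) 1 ^ (ε : ℤ))) := by
    rw [incl_ofBraid, map_mul (BraidB.incl _), map_zpow (BraidB.incl _), map_zpow (BraidB.incl _),
      BraidB.incl_t, BraidB.incl_sigma (by omega)]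
  rw [bandDiff_apply, bandDiff_apply, shift_incl q r hn, h, ← map_mul (incl _ _),
    markovTrace_incl q z (Nat.le_add_left 1 n), markovTrace_incl q z hn, smul_sub, smul_smul,
    smul_smul,
    ← Units.val_mul, ← Units.val_mul, ← mul_assoc, ← pow_succ', ← pow_succ',
    Nat.sub_add_cancel hn, Nat.add_sub_cancel]

/-- Both traces obey the Markov rule: the shift sends the last crossing to the last crossing, and
the factor `t^p σ_1^{±1}` comes from one strand fewer. -/
theorem bandDiff_incl_mul_gen (hn : 1 ≤ n) (p : ℤ) (ε : ℤˣ) (x : HeckeB K q n) :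
    bandDiff q z r p ε (n + 1) (incl q n x * gen q (n + 1) n) =
      ((r⁻¹ : Kˣ) : K) • bandDiff q z r p ε n x := by
  have h : ofBraid q (n + 2) (t (n + 2) ^ p * sigma (n + 2) 1 ^ (ε : ℤ)) =
      incl q (n + 1) (ofBraid q (n + 1) (t (n + 1) ^ p * sigma (n + 1) 1 ^ (ε : ℤ))) := by
    rw [incl_ofBraid, map_mul (BraidB.incl _), map_zpow (BraidB.incl _), map_zpow (BraidB.incl _),
      BraidB.incl_t, BraidB.incl_sigma (by omega)]
  have hg : shift q r (n + 1) (gen q (n + 1) n) = ofBraid q (n + 2) (sigma (n + 2) (n + 1)) := by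
    rw [gen, shift_ofBraid, shiftScalar_sigma r (by omega), BraidB.shift_sigma (by omega),
      Units.val_one, one_smul]
  -- The normalization is chosen so that `normFactor z r * z = r⁻¹`.
  have e (m : ℕ) : normFactor z r ^ (m + 1) * z = normFactor z r ^ m * r⁻¹ := by
    rw [pow_succ, mul_assoc]; congr 1; simp [normFactor, mul_comm]
  rw [bandDiff_apply, bandDiff_apply, map_mul (shift _ _ _), shift_incl q r hn, h, hg, ← mul_assoc,
    ← map_mul (incl _ _),
    markovTrace_markov q z (by omega)]
  rw [gen, markovTrace_markov q z hn, smul_sub, smul_smul, smul_smul, smul_smul, smul_smul,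
    ← Units.val_mul, ← Units.val_mul, ← Units.val_mul, ← Units.val_mul, Nat.add_sub_cancel,
    mul_right_comm, e n]
  obtain ⟨m, rfl⟩ : ∃ m, n = m + 1 := ⟨n - 1, by omega⟩
  rw [e m, Nat.add_sub_cancel, mul_comm r⁻¹, mul_comm r⁻¹, mul_right_comm]

/-- Expanding `σ_n⁻¹` combines the two previous lemmas to the factor `q⁻¹ r⁻¹ + (q⁻¹ - 1) z⁻¹ r⁻¹`;
that this equals `r` is the defining equation of `λ = r²`. -/
theorem bandDiff_incl_mul_inv (hr : (r : K) ^ 2 * (q * z) = z + 1 - q) (hn : 1 ≤ n) (p : ℤ)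
    (ε : ℤˣ) (x : HeckeB K q n) :
    bandDiff q z r p ε (n + 1) (incl q n x * ofBraid q (n + 1) (sigma (n + 1) n)⁻¹) =
      (r : K) • bandDiff q z r p ε n x := by
  rw [ofBraid_sigma_inv q (by omega), mul_add, mul_smul_comm, mul_smul_comm, mul_one, map_add,
    map_smul, map_smul, bandDiff_incl q z r hn, bandDiff_incl_mul_gen q z r hn, smul_smul,
    smul_smul, ← add_smul]
  congr 1
  have hq : (↑q⁻¹ : K) * q = 1 := Units.inv_mul q
  have hz : (↑z⁻¹ : K) * z = 1 := Units.inv_mul z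
  have hrr : (↑r⁻¹ : K) * r = 1 := Units.inv_mul r
  have hN : (normFactor z r : K) = (↑z⁻¹ : K) * (↑r⁻¹ : K) := by
    simp [normFactor, mul_comm]
  rw [hN]
  generalize (↑q⁻¹ : K) = a at *
  generalize (↑z⁻¹ : K) = b at *
  generalize (↑r⁻¹ : K) = c at *
  linear_combination (-a * b * c) * hr + (-a * c + r) * hz + (b * c + r * b * z) * hq +
    (r * a * q * b * z) * hrr

/-- The elements that commute with everything up to elements on which `bandDiff` vanishes. -/
noncomputable def slideSubalgebra (p : ℤ) (n : ℕ) : Subalgebra K (HeckeB K q n) where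
  carrier := {h | ∀ (ε : ℤˣ) x, bandDiff q z r p ε n (h * x) = bandDiff q z r p ε n (x * h)}
  mul_mem' {a b} ha hb ε x := by rw [mul_assoc, ha, mul_assoc, hb, mul_assoc]
  add_mem' {a b} ha hb ε x := by rw [add_mul, mul_add, map_add, map_add, ha, hb]
  algebraMap_mem' c ε x := by rw [Algebra.commutes]

/-- The sliding property of `b` is applied to `b⁻¹ x b⁻¹`. -/
theorem ofBraid_inv_mem_slideSubalgebra {p : ℤ} {b : BraidB n}
    (hb : ofBraid q n b ∈ slideSubalgebra q z r p n) :
    ofBraid q n b⁻¹ ∈ slideSubalgebra q z r p n := fun ε x => by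
  have := hb ε (ofBraid q n b⁻¹ * x * ofBraid q n b⁻¹)
  rw [← mul_assoc, ← mul_assoc, ofBraid_mul_inv, one_mul, mul_assoc _ _ (ofBraid q n b),
    ofBraid_inv_mul, mul_one] at this
  exact this.symm

/-- The shifted crossing `σ_{i+1}` has `i + 1 > 2`, so it passes `t^p σ_1^{±1}` and cycles around
the trace. -/
theorem gen_mem_slideSubalgebra (hn : 1 ≤ n) (p : ℤ) {i : ℕ} (h1 : 1 < i) (hi : i < n) :
    gen q n i ∈ slideSubalgebra q z r p n := fun ε x => by
  have hg : shift q r n (gen q n i) = ofBraid q (n + 1) (sigma (n + 1) (i + 1)) := by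
    rw [gen, shift_ofBraid, shiftScalar_sigma r (by omega), BraidB.shift_sigma (by omega),
      Units.val_one, one_smul]
  have hc : Commute (t (n + 1) ^ p * sigma (n + 1) 1 ^ (ε : ℤ)) (sigma (n + 1) (i + 1)) :=
    ((BraidB.commute_t_sigma (by omega)).zpow_left p).mul_left
      ((BraidB.commute_sigma (by omega)).zpow_left _)
  rw [bandDiff_apply, bandDiff_apply, markovTrace_comm q z hn, map_mul (shift _ _ _),
    map_mul (shift _ _ _), hg, ← mul_assoc,
    ((hc.map (ofBraid q (n + 1))).eq), mul_assoc,
    markovTrace_comm q z (n := n + 1) (by omega), mul_assoc]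

/-- The shifted loop `t_1` need not commute with `t^p σ_1^{±1}`, but `t_1 t` does, by the four-term
relation. The extra `t` is inserted and removed at no cost, as it commutes with every shifted
element. -/
theorem t_mem_slideSubalgebra (hn : 1 ≤ n) (p : ℤ) :
    ofBraid q n (t n) ∈ slideSubalgebra q z r p n := fun ε x => by
  have hc : Commute (t (n + 1) ^ p * sigma (n + 1) 1 ^ (ε : ℤ))
      (BraidB.shift n (t n) * t (n + 1)) := by
    have h1 : Commute (t (n + 1)) (BraidB.shift n (t n)) := BraidB.commute_t_shift _
    have h2 : Commute (sigma (n + 1) 1) (BraidB.shift n (t n) * t (n + 1)) := by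
      have := BraidB.four (n := n + 1) (by omega)
      rw [BraidB.shift_t]
      change _ * _ = _ * _
      simp only [mul_assoc] at this ⊢
      rw [this]
    exact ((h1.mul_right (Commute.refl _)).zpow_left p).mul_left (h2.zpow_left _)
  have hc' := (hc.map (ofBraid q (n + 1))).eq
  rw [map_mul (ofBraid q (n + 1)) (BraidB.shift n (t n))] at hc'
  have hx := (commute_t_shift q r x).eq
  have hi := ofBraid_mul_inv q (t (n + 1))
  have hi' := ofBraid_inv_mul q (t (n + 1))
  have hTS := ((BraidB.commute_t_shift (t n)).map (ofBraid q (n + 1))).eq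
  rw [bandDiff_apply, bandDiff_apply, markovTrace_comm q z hn, map_mul (shift _ _ _),
    map_mul (shift _ _ _), shift_ofBraid]
  simp only [smul_mul_assoc, mul_smul_comm, map_smul]
  congr 3
  generalize ofBraid q (n + 1) (t (n + 1) ^ p * sigma (n + 1) 1 ^ (ε : ℤ)) = P at *
  generalize ofBraid q (n + 1) (t (n + 1))⁻¹ = T' at *
  generalize ofBraid q (n + 1) (t (n + 1)) = T at *
  generalize ofBraid q (n + 1) (BraidB.shift n (t n)) = S at *
  generalize shift q r n x = y at *
  calc markovTrace q z (n + 1) (P * (S * y))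
      = markovTrace q z (n + 1) (P * (S * T) * y * T') := by
        congr 1
        rw [mul_assoc P, mul_assoc S, mul_assoc, mul_assoc, hx, mul_assoc y, hi, mul_one]
    _ = markovTrace q z (n + 1) (S * T * (P * y * T')) := by rw [hc']; simp only [mul_assoc]
    _ = markovTrace q z (n + 1) (P * y * (T' * (S * T))) := by
        rw [markovTrace_comm q z (by omega)]; simp only [mul_assoc]
    _ = markovTrace q z (n + 1) (P * (y * S)) := by
        rw [← hTS, ← mul_assoc T', hi', one_mul, mul_assoc]

end HeckeB

/-! Elements `x` and `y = g x g` with `g` satisfying a Hecke relation. -/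

section Intertwine

variable {K R : Type*} [CommRing K] [Ring R] [Algebra K R] {U : Submodule K R} {g x y : R}
  {q : Kˣ}

theorem mul_intertwiner (hg : g * g = ((q : K) - 1) • g + (q : K) • 1) (hy : y = g * x * g) :
    y * g = (q : K) • (g * x) + ((q : K) - 1) • y := by
  rw [hy, mul_assoc, hg, mul_add, mul_smul_comm, mul_smul_comm, mul_one, add_comm]

theorem intertwiner_mul (hg : g * g = ((q : K) - 1) • g + (q : K) • 1) (hy : y = g * x * g) :
    g * x = (↑q⁻¹ : K) • (y * g) - ((↑q⁻¹ : K) * (q - 1)) • y := by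
  rw [mul_intertwiner hg hy, smul_add, smul_smul, smul_smul, Units.inv_mul, one_smul]
  simp

/-- If a submodule that is stable under right multiplication by `g` contains `g x^a` and the mixed
products `x^i y^j`, `i + j = a`, then it contains `y^a`. -/
theorem pow_mem_of_intertwine (hg : g * g = ((q : K) - 1) • g + (q : K) • 1)
    (hy : y = g * x * g) (hxy : Commute x y) (hU : ∀ u ∈ U, u * g ∈ U) (a : ℕ)
    (h1 : g * x ^ (a + 1) ∈ U)
    (h2 : ∀ i j, i + j = a + 1 → i ≠ 0 → j ≠ 0 → x ^ i * y ^ j ∈ U) : y ^ (a + 1) ∈ U := by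
  -- At fixed total degree, `y g = q g x + (q - 1) y` trades a `y` left of `g` for an `x` right of
  -- it, the error being a mixed product; for `j = 0` a final `g` turns `y^a g x` into `y^(a+1)`.
  have key : ∀ i j, i + j = a → y ^ i * g * x ^ (j + 1) ∈ U := by
    intro i
    induction i with
    | zero =>
      intro j hj
      obtain rfl : j = a := by omega
      simpa using h1
    | succ i ih =>
      intro j hj
      have e : y ^ (i + 1) * g * x ^ (j + 1) =
          (q : K) • (y ^ i * g * x ^ (j + 1 + 1)) +
            ((q : K) - 1) • (x ^ (j + 1) * y ^ (i + 1)) := by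
        rw [(hxy.pow_pow (j + 1) (i + 1)).eq, pow_succ y, mul_assoc (y ^ i),
          mul_intertwiner hg hy, pow_succ' x (j + 1)]
        simp only [mul_add, add_mul, mul_smul_comm, smul_mul_assoc, mul_assoc]
      rw [e]
      exact U.add_mem (U.smul_mem _ (ih (j + 1) (by omega)))
        (U.smul_mem _ (h2 _ _ (by omega) (by omega) (by omega)))
  have := hU _ (key a 0 (by omega))
  rwa [zero_add, pow_one, mul_assoc, mul_assoc, ← mul_assoc g, ← hy, ← pow_succ] at this

/-- If a submodule that is stable under right multiplication by `g` contains the products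
`x^i y^j`, `i + j = a`, then it contains `g x^a`. -/
theorem mul_pow_mem_of_intertwine (hg : g * g = ((q : K) - 1) • g + (q : K) • 1)
    (hy : y = g * x * g) (hxy : Commute x y) (hU : ∀ u ∈ U, u * g ∈ U) (a : ℕ)
    (h2 : ∀ i j, i + j = a → x ^ i * y ^ j ∈ U) : g * x ^ a ∈ U := by
  have key : ∀ j i, i + j = a → y ^ i * g * x ^ j ∈ U := by
    intro j
    induction j with
    | zero =>
      intro i hi
      simpa using hU _ (h2 0 i (by omega))
    | succ j ih =>
      intro i hi
      have e : y ^ i * g * x ^ (j + 1) = (↑q⁻¹ : K) • (y ^ (i + 1) * g * x ^ j) -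
          ((↑q⁻¹ : K) * (q - 1)) • (x ^ j * y ^ (i + 1)) := by
        rw [(hxy.pow_pow j (i + 1)).eq, pow_succ' x, ← mul_assoc, mul_assoc (y ^ i),
          intertwiner_mul hg hy, pow_succ y]
        simp only [mul_sub, sub_mul, mul_smul_comm, smul_mul_assoc, mul_assoc]
      rw [e]
      exact U.sub_mem (U.smul_mem _ (ih (i + 1) (by omega)))
        (U.smul_mem _ (h2 _ _ (by omega)))
  simpa using key a 0 (by omega)

end Intertwine

/-! ### Exponent vectors with gaps and filling of gaps. -/

namespace BraidB

variable {n : ℕ}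

theorem monomial_update {j : ℕ} (hj : j + 1 < n) (k : ℕ → ℤ) (b c : ℤ) :
    monomial n n (Function.update (Function.update k j b) (j + 1) c) =
      monomial n n (Function.update (Function.update k j 0) (j + 1) 0) *
        (loop n j ^ b * loop n (j + 1) ^ c) := by
  rw [monomial_eq hj]
  congr 2
  · funext i
    by_cases h1 : i = j + 1
    · subst h1; simp
    · by_cases h2 : i = j
      · subst h2; simp
      · simp [h1, h2]
  · rw [Function.update_of_ne (by omega), Function.update_self]
  · rw [Function.update_self]

theorem loop_succ_zpow_unit (j : ℕ) (s : ℤˣ) : loop n (j + 1) ^ (s : ℤ) =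
    sigma n (j + 1) ^ (s : ℤ) * loop n j ^ (s : ℤ) * sigma n (j + 1) ^ (s : ℤ) := by
  rcases Int.units_eq_one_or s with rfl | rfl
  · simp [loop_succ]
  · simp [loop_succ, mul_assoc]

/-- The total depth of the gaps among the first `n` exponents. -/
def gapWeight (n : ℕ) (k : ℕ → ℤ) : ℕ := ∑ i ∈ Finset.range n, if k i = 0 then n - i else 0

/-- Filling the gap at `j` gains `n - j`, while a gap newly opened at `j + 1` costs only `n - j -
1`. -/
theorem gapWeight_lt {k l : ℕ → ℤ} {j : ℕ} (hj : j + 1 < n) (hk : k j = 0)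
    (hl : l j ≠ 0) (h : ∀ i, i ≠ j → i ≠ j + 1 → l i = k i) : gapWeight n l < gapWeight n k := by
  have hs (f : ℕ → ℕ) : ∑ i ∈ Finset.range n, f i =
      f j + (f (j + 1) + ∑ i ∈ ((Finset.range n).erase j).erase (j + 1), f i) := by
    rw [Finset.add_sum_erase _ _ (by simp [hj]), Finset.add_sum_erase _ _ (by simp; omega)]
  rw [gapWeight, gapWeight, hs, hs, if_pos hk, if_neg hl]
  have : ∑ i ∈ ((Finset.range n).erase j).erase (j + 1), (if l i = 0 then n - i else 0) =
      ∑ i ∈ ((Finset.range n).erase j).erase (j + 1), if k i = 0 then n - i else 0 := by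
    refine Finset.sum_congr rfl fun i hi => ?_
    simp only [Finset.mem_erase] at hi
    rw [h i hi.2.1 hi.1]
  rw [this]
  split_ifs <;> omega

theorem exists_gap {k : ℕ → ℤ} (hk : ∃ i < n, k i ≠ 0)
    (h : ¬∃ m < n, (∀ i ≤ m, k i ≠ 0) ∧ ∀ i, m < i → i < n → k i = 0) :
    ∃ j, j + 1 < n ∧ k j = 0 ∧ k (j + 1) ≠ 0 := by
  by_contra! hc
  obtain ⟨i, hi, hki⟩ := hk
  classical
  -- If no gap precedes a nonzero exponent, nonvanishing propagates downwards from the last nonzero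
  -- index `m`.
  let m := Nat.findGreatest (fun i => k i ≠ 0) (n - 1)
  have hm : k m ≠ 0 := Nat.findGreatest_spec (P := fun i => k i ≠ 0) (by omega : i ≤ n - 1) hki
  have hmn : m ≤ n - 1 := Nat.findGreatest_le _
  refine h ⟨m, by omega, ?_, fun i h1 h2 => ?_⟩
  · intro i hi
    induction hi using Nat.decreasingInduction with
    | self => exact hm
    | of_succ j hj ih => exact fun h0 => ih (hc j (by omega) h0)
  · by_contra h0
    exact Nat.findGreatest_is_greatest h1 (by omega) h0

end BraidB

namespace HeckeB

open BraidB (sigma t loop desc monomial gapWeight)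

variable {K : Type*} [CommRing K] (q : Kˣ) {n : ℕ} {V : Submodule K (HeckeB K q n)}

/-- As `σ_i⁻¹` satisfies the quadratic relation with `q⁻¹` and `t_{j+1}⁻¹ = σ⁻¹ t_j⁻¹ σ⁻¹`, the
exchange lemmas cover exponents of both signs. -/
theorem ofBraid_zpow_unit_mul_self {i : ℕ} (hi : 1 ≤ i ∧ i < n) (s : ℤˣ) :
    ofBraid q n (sigma n i ^ (s : ℤ)) * ofBraid q n (sigma n i ^ (s : ℤ)) =
      (((q ^ (s : ℤ) : Kˣ) : K) - 1) • ofBraid q n (sigma n i ^ (s : ℤ)) +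
        ((q ^ (s : ℤ) : Kˣ) : K) • 1 := by
  rcases Int.units_eq_one_or s with rfl | rfl
  · simpa [gen] using gen_mul_self q hi
  · simp only [Units.val_neg, Units.val_one, zpow_neg, zpow_one]
    nth_rw 1 [ofBraid_sigma_inv q hi]
    rw [add_mul, smul_mul_assoc, gen, ofBraid_mul_inv, smul_mul_assoc, one_mul, add_comm]

theorem mul_ofBraid_zpow_mem {i : ℕ} (hi : 1 ≤ i ∧ i < n) (hV : ∀ v ∈ V, v * gen q n i ∈ V)
    (s : ℤˣ) : ∀ v ∈ V, v * ofBraid q n (sigma n i ^ (s : ℤ)) ∈ V := fun v hv => by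
  rcases Int.units_eq_one_or s with rfl | rfl
  · simpa [gen] using hV v hv
  · simp only [Units.val_neg, Units.val_one, zpow_neg, zpow_one]
    rw [ofBraid_sigma_inv q hi, mul_add, mul_smul_comm, mul_smul_comm, mul_one]
    exact V.add_mem (V.smul_mem _ (hV v hv)) (V.smul_mem _ hv)

theorem ofBraid_zpow_mul_mem {i : ℕ} (hi : 1 ≤ i ∧ i < n) (hV : ∀ v ∈ V, gen q n i * v ∈ V)
    (s : ℤˣ) : ∀ v ∈ V, ofBraid q n (sigma n i ^ (s : ℤ)) * v ∈ V := fun v hv => by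
  rcases Int.units_eq_one_or s with rfl | rfl
  · simpa [gen] using hV v hv
  · simp only [Units.val_neg, Units.val_one, zpow_neg, zpow_one]
    rw [ofBraid_sigma_inv q hi, add_mul, smul_mul_assoc, smul_mul_assoc, one_mul]
    exact V.add_mem (V.smul_mem _ (hV v hv)) (V.smul_mem _ hv)

theorem exists_zpow_unit (a : ℤ) : ∃ (s : ℤˣ) (m : ℕ), a = s * m := by
  rcases Int.natAbs_eq a with h | h
  · exact ⟨1, a.natAbs, by simpa using h⟩
  · exact ⟨-1, a.natAbs, by simpa using h⟩

/-- A submodule that is stable under multiplication by the `g_i` on both sides and contains all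
monomials without gaps contains all nontrivial monomials. -/
theorem monomial_mem_of_gapfree (hR : ∀ i, 1 ≤ i ∧ i < n → ∀ v ∈ V, v * gen q n i ∈ V)
    (hL : ∀ i, 1 ≤ i ∧ i < n → ∀ v ∈ V, gen q n i * v ∈ V)
    (h0 : ∀ k : ℕ → ℤ, (∃ m < n, (∀ i ≤ m, k i ≠ 0) ∧ ∀ i, m < i → i < n → k i = 0) →
      ofBraid q n (monomial n n k) ∈ V)
    (k : ℕ → ℤ) (hk : ∃ i < n, k i ≠ 0) : ofBraid q n (monomial n n k) ∈ V := by
  induction hw : gapWeight n k using Nat.strong_induction_on generalizing k with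
  | _ w ih =>
    subst hw
    by_cases hgap : ∃ m < n, (∀ i ≤ m, k i ≠ 0) ∧ ∀ i, m < i → i < n → k i = 0
    · exact h0 k hgap
    obtain ⟨j, hj, hkj, hkj'⟩ := BraidB.exists_gap hk hgap
    have hi : 1 ≤ j + 1 ∧ j + 1 < n := ⟨by omega, hj⟩
    obtain ⟨s, a, ha⟩ := exists_zpow_unit (k (j + 1))
    obtain ⟨a, rfl⟩ : ∃ b, a = b + 1 :=
      ⟨a - 1, by rcases a with _ | a; · simp [ha] at hkj'
                 rfl⟩
    have hs : (s : ℤ) ≠ 0 := s.ne_zero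
    set m := monomial n n (Function.update (Function.update k j 0) (j + 1) 0) with hm
    have hc : Commute m (sigma n (j + 1)) :=
      BraidB.commute_monomial_sigma (by simp) (by simp)
    have hmem (b c : ℤ) (hb : b ≠ 0) :
        ofBraid q n m * ofBraid q n (loop n j ^ b * loop n (j + 1) ^ c) ∈ V := by
      rw [← map_mul, hm, ← BraidB.monomial_update hj]
      refine ih _ (BraidB.gapWeight_lt hj hkj ?_ fun i h1 h2 => ?_) _ ?_ rfl
      · simpa using hb
      · simp [h1, h2]
      · exact ⟨j, by omega, by simpa using hb⟩
    have hcomm : Commute (loop n j ^ (s : ℤ)) (loop n (j + 1) ^ (s : ℤ)) :=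
      (BraidB.commute_loop (by omega) hj).zpow_zpow _ _
    -- The power of `t_{j+1}` after the gap at `j` is rewritten by monomials with a nonzero exponent
    -- at `j`, all of smaller weight; the rest `m` of the monomial commutes with `σ_{j+1}`.
    have := pow_mem_of_intertwine (U := V.comap (LinearMap.mulLeft K (ofBraid q n m)))
      (ofBraid_zpow_unit_mul_self q hi s)
      (x := ofBraid q n (loop n j ^ (s : ℤ))) (y := ofBraid q n (loop n (j + 1) ^ (s : ℤ)))
      (by rw [BraidB.loop_succ_zpow_unit, map_mul, map_mul]) (hcomm.map _)
      (fun u hu => by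
        rw [Submodule.mem_comap, LinearMap.mulLeft_apply] at hu ⊢
        rw [← mul_assoc]
        exact mul_ofBraid_zpow_mem q hi (hR _ hi) s _ hu) a
      (by
        rw [Submodule.mem_comap, LinearMap.mulLeft_apply, ← mul_assoc, ← map_mul,
          (hc.zpow_right _).eq, map_mul, mul_assoc, ← map_pow, ← zpow_natCast, ← zpow_mul]
        refine ofBraid_zpow_mul_mem q hi (hL _ hi) s _ ?_
        have := hmem (s * (a + 1 : ℕ)) 0 (mul_ne_zero hs (by positivity))
        simpa using this)
      (fun i l hil h1 h2 => by
        rw [Submodule.mem_comap, LinearMap.mulLeft_apply, ← map_pow, ← map_pow, ← map_mul,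
          ← zpow_natCast, ← zpow_natCast, ← zpow_mul, ← zpow_mul]
        exact hmem _ _ (mul_ne_zero hs (by exact_mod_cast h1)))
    rw [Submodule.mem_comap, LinearMap.mulLeft_apply, ← map_pow, ← zpow_natCast, ← zpow_mul,
      ← map_mul] at this
    rw [BraidB.monomial_eq hj, hkj, ha, zpow_zero, one_mul]
    exact this

/-- A submodule that is stable under right multiplication by the `g_i` and contains all monomials
contains all products of some `g_i` with a monomial. -/
theorem gen_mul_monomial_mem (hR : ∀ i, 1 ≤ i ∧ i < n → ∀ v ∈ V, v * gen q n i ∈ V)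
    (h0 : ∀ k, ofBraid q n (monomial n n k) ∈ V) {j : ℕ} (hj : j + 1 < n) (k : ℕ → ℤ) :
    gen q n (j + 1) * ofBraid q n (monomial n n k) ∈ V := by
  have hi : 1 ≤ j + 1 ∧ j + 1 < n := ⟨by omega, hj⟩
  -- The common power `(t_j t_{j+1})^c` commutes with `σ_{j+1}`; once it is split off, only a power
  -- of `t_j` has to be crossed.
  set c := k (j + 1) with hcdef
  obtain ⟨s, a, ha⟩ := exists_zpow_unit (k j - c)
  have hxy : Commute (loop n j) (loop n (j + 1)) := BraidB.commute_loop (by omega) hj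
  set m := monomial n n (Function.update (Function.update k j c) (j + 1) c) with hm
  have hmul (b d : ℤ) : m * (loop n j ^ b * loop n (j + 1) ^ d) =
      monomial n n (Function.update (Function.update k j (c + b)) (j + 1) (c + d)) := by
    rw [hm, BraidB.monomial_update hj k c, BraidB.monomial_update hj k (c + b), mul_assoc,
      zpow_add, zpow_add, mul_assoc, mul_assoc, ← mul_assoc (loop n (j + 1) ^ c), ← (hxy.zpow_zpow b c).eq]
    simp only [mul_assoc]
  have hc : Commute m (sigma n (j + 1)) := by
    rw [hm, BraidB.monomial_update hj]
    refine (BraidB.commute_monomial_sigma (by simp) (by simp)).mul_left ?_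
    rw [← hxy.mul_zpow]
    refine Commute.zpow_left ?_ c
    have := hxy.eq
    rw [BraidB.loop_succ] at this ⊢
    refine (congrArg (· * sigma n (j + 1)) this).trans ?_
    simp only [mul_assoc]
  have hmem (b d : ℤ) :
      ofBraid q n m * ofBraid q n (loop n j ^ b * loop n (j + 1) ^ d) ∈ V := by
    rw [← map_mul, hmul]; exact h0 _
  have := mul_pow_mem_of_intertwine (U := V.comap (LinearMap.mulLeft K (ofBraid q n m)))
    (ofBraid_zpow_unit_mul_self q hi s)
    (x := ofBraid q n (loop n j ^ (s : ℤ))) (y := ofBraid q n (loop n (j + 1) ^ (s : ℤ)))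
    (by rw [BraidB.loop_succ_zpow_unit, map_mul, map_mul]) ((hxy.zpow_zpow _ _).map _)
    (fun u hu => by
      rw [Submodule.mem_comap, LinearMap.mulLeft_apply] at hu ⊢
      rw [← mul_assoc]
      exact mul_ofBraid_zpow_mem q hi (hR _ hi) s _ hu) a
    (fun i l hil => by
      rw [Submodule.mem_comap, LinearMap.mulLeft_apply, ← map_pow, ← map_pow, ← map_mul,
        ← zpow_natCast, ← zpow_natCast, ← zpow_mul, ← zpow_mul]
      exact hmem _ _)
  rw [Submodule.mem_comap, LinearMap.mulLeft_apply, ← map_pow, ← zpow_natCast, ← zpow_mul, ← ha,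
    ← map_mul, ← map_mul, ← mul_assoc, (hc.zpow_right _).eq, mul_assoc] at this
  have hk : m * loop n j ^ (k j - c) = monomial n n k := by
    have := hmul (k j - c) 0
    rw [zpow_zero, mul_one] at this
    rw [this]
    congr 1
    funext i
    by_cases h1 : i = j + 1
    · subst h1; simp [hcdef]
    · simp [h1]
  rw [hk, map_mul] at this
  rcases Int.units_eq_one_or s with rfl | rfl
  · simpa [gen] using this
  · simp only [Units.val_neg, Units.val_one, zpow_neg, zpow_one] at this
    rw [gen_eq q hi, add_mul, smul_mul_assoc, smul_mul_assoc, one_mul]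
    exact V.add_mem (V.smul_mem _ this) (V.smul_mem _ (h0 k))

end HeckeB

theorem Algebra.mul_mem_of_mem_adjoin {K R : Type*} [CommRing K] [Ring R] [Algebra K R]
    {V : Submodule K R} {S : Set R} (hV : ∀ s ∈ S, ∀ v ∈ V, v * s ∈ V) {a : R}
    (ha : a ∈ Algebra.adjoin K S) : ∀ v ∈ V, v * a ∈ V := by
  induction ha using Algebra.adjoin_induction with
  | mem s hs => exact hV s hs
  | algebraMap c =>
    intro v hv
    rw [← Algebra.commutes, ← Algebra.smul_def]
    exact V.smul_mem _ hv
  | add a b _ _ iha ihb => intro v hv; rw [mul_add]; exact V.add_mem (iha v hv) (ihb v hv)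
  | mul a b _ _ iha ihb => intro v hv; rw [← mul_assoc]; exact ihb _ (iha v hv)

/-! ### Braiding tails and spanning sets; `tailsFrom 0 n n` is `tails n`. -/

namespace BraidB

variable {n : ℕ}

/-- Products over `i < m` of descending blocks made of crossings of index greater than `s`. -/
def tailsFrom (s n m : ℕ) : Set (BraidB n) :=
  {w | ∃ d : ℕ → ℕ, (∀ i, d i ≤ i - s) ∧ w = ((List.range m).map fun i => desc n i (d i)).prod}

theorem tailsFrom_zero_right (s : ℕ) : tailsFrom s n 0 = {1} := by
  ext w
  simp only [tailsFrom, List.range_zero, List.map_nil, List.prod_nil, Set.mem_ofPred_eq,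
    Set.mem_singleton_iff]
  exact ⟨fun ⟨_, _, h⟩ => h, fun h => ⟨0, by simp, h⟩⟩

theorem mem_tailsFrom_succ {s m : ℕ} {w : BraidB n} : w ∈ tailsFrom s n (m + 1) ↔
    ∃ w' ∈ tailsFrom s n m, ∃ d ≤ m - s, w = w' * desc n m d := by
  constructor
  · rintro ⟨d, hd, rfl⟩
    exact ⟨_, ⟨d, hd, rfl⟩, d m, hd m, by simp [List.range_succ]⟩
  · rintro ⟨_, ⟨d, hd, rfl⟩, e, he, rfl⟩
    refine ⟨Function.update d m e, fun i => ?_, ?_⟩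
    · rcases eq_or_ne i m with rfl | h
      · simpa using he
      · simpa [h] using hd i
    · rw [List.range_succ, List.map_append, List.prod_append]
      simp only [List.map_cons, List.map_nil, List.prod_cons, List.prod_nil, mul_one,
        Function.update_self]
      congr 2
      refine List.map_congr_left fun i hi => ?_
      rw [Function.update_of_ne]
      rw [List.mem_range] at hi
      omega

theorem one_mem_tailsFrom (s m : ℕ) : (1 : BraidB n) ∈ tailsFrom s n m :=
  ⟨0, by simp, by simp [desc_zero]⟩

theorem exists_incl_of_mem_tailsFrom {s m : ℕ} (hm : m ≤ n) {w : BraidB (n + 1)}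
    (hw : w ∈ tailsFrom s (n + 1) m) : ∃ w' ∈ tailsFrom s n m, incl n w' = w := by
  induction m generalizing w with
  | zero =>
    rw [tailsFrom_zero_right] at hw ⊢
    exact ⟨1, rfl, by rw [map_one]; exact hw.symm⟩
  | succ m ih =>
    obtain ⟨u, hu, d, hd, rfl⟩ := mem_tailsFrom_succ.mp hw
    obtain ⟨u', hu', rfl⟩ := ih (by omega) hu
    exact ⟨u' * desc n m d, mem_tailsFrom_succ.mpr ⟨u', hu', d, hd, rfl⟩, by
      rw [map_mul, incl_desc (by omega) (by omega)]⟩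

end BraidB

namespace HeckeB

open BraidB (sigma t loop desc monomial tailsFrom)

variable {K : Type*} [CommRing K] (q : Kˣ) {n : ℕ}

/-- The subalgebra generated by the `g_j` with `j > s`. -/
noncomputable def genSubalgebra (s n : ℕ) : Subalgebra K (HeckeB K q n) :=
  Algebra.adjoin K {x | ∃ j, s < j ∧ j < n ∧ x = gen q n j}

variable {q}

theorem gen_mem_genSubalgebra {s j : ℕ} (hs : s < j) (hj : j < n) :
    gen q n j ∈ genSubalgebra q s n := Algebra.subset_adjoin ⟨j, hs, hj, rfl⟩

theorem genSubalgebra_one_le_zero : genSubalgebra q 1 n ≤ genSubalgebra q 0 n := by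
  refine Algebra.adjoin_le ?_
  rintro _ ⟨j, hj, hjn, rfl⟩
  exact gen_mem_genSubalgebra (by omega) hjn

theorem ofBraid_sigma_inv_mem_genSubalgebra {s j : ℕ} (hs : s < j) (hj : j < n) :
    ofBraid q n (sigma n j)⁻¹ ∈ genSubalgebra q s n := by
  rw [ofBraid_sigma_inv q (by omega)]
  exact add_mem (Subalgebra.smul_mem _ (gen_mem_genSubalgebra hs hj) _)
    (Subalgebra.smul_mem _ (one_mem _) _)

theorem ofBraid_desc_mem_genSubalgebra {s i d : ℕ} (hi : i < n) (hd : d ≤ i - s) :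
    ofBraid q n (desc n i d) ∈ genSubalgebra q s n ∧
      ofBraid q n (desc n i d)⁻¹ ∈ genSubalgebra q s n := by
  induction d with
  | zero => rw [BraidB.desc_zero, inv_one, map_one]; exact ⟨one_mem _, one_mem _⟩
  | succ d ih =>
    obtain ⟨h1, h2⟩ := ih (by omega)
    rw [BraidB.desc_succ, mul_inv_rev, map_mul, map_mul]
    exact ⟨mul_mem h1 (gen_mem_genSubalgebra (by omega) (by omega)),
      mul_mem (ofBraid_sigma_inv_mem_genSubalgebra (by omega) (by omega)) h2⟩

theorem ofBraid_tail_mem_genSubalgebra {s m : ℕ} (hm : m ≤ n) {w : BraidB n}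
    (hw : w ∈ tailsFrom s n m) : ofBraid q n w ∈ genSubalgebra q s n := by
  induction m generalizing w with
  | zero =>
    rw [BraidB.tailsFrom_zero_right] at hw
    rw [hw, map_one]
    exact one_mem _
  | succ m ih =>
    obtain ⟨u, hu, d, hd, rfl⟩ := BraidB.mem_tailsFrom_succ.mp hw
    rw [map_mul]
    exact mul_mem (ih (by omega) hu) (ofBraid_desc_mem_genSubalgebra (by omega) hd).1

variable (q) in
/-- The span of the tails in `tailsFrom s n m`. -/
noncomputable def tailSpan (s n m : ℕ) : Submodule K (HeckeB K q n) :=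
  Submodule.span K (ofBraid q n '' tailsFrom s n m)

theorem mul_desc_mem_tailSpan {s m d : ℕ} (hd : d ≤ m - s) {u : HeckeB K q n}
    (hu : u ∈ tailSpan q s n m) : u * ofBraid q n (desc n m d) ∈ tailSpan q s n (m + 1) := by
  induction hu using Submodule.span_induction with
  | mem x hx =>
    obtain ⟨w, hw, rfl⟩ := hx
    rw [← map_mul]
    exact Submodule.subset_span ⟨_, BraidB.mem_tailsFrom_succ.mpr ⟨w, hw, d, hd, rfl⟩, rfl⟩
  | zero => rw [zero_mul]; exact zero_mem _
  | add x y _ _ hx hy => rw [add_mul]; exact add_mem hx hy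
  | smul c x _ hx => rw [smul_mul_assoc]; exact Submodule.smul_mem _ _ hx

/-- Against the last block `σ_m ⋯ σ_{m-d+1}`, the factor `g_j` either commutes past it, extends it,
meets its final letter and is reduced by the quadratic relation, or passes through as `g_{j-1}`. In
the last case `d ≤ m - s` forces `j - 1 > s`. -/
theorem mul_gen_mem_tailSpan {s m j : ℕ} (hm : m ≤ n) (hs : s < j) (hj : j < m)
    {v : HeckeB K q n} (hv : v ∈ tailSpan q s n m) : v * gen q n j ∈ tailSpan q s n m := by
  induction m generalizing j v with
  | zero => omega
  | succ m ih =>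
    induction hv using Submodule.span_induction with
    | zero => rw [zero_mul]; exact zero_mem _
    | add x y _ _ hx hy => rw [add_mul]; exact add_mem hx hy
    | smul c x _ hx => rw [smul_mul_assoc]; exact Submodule.smul_mem _ _ hx
    | mem x hx =>
      obtain ⟨w, hw, rfl⟩ := hx
      obtain ⟨u, hu, d, hd, rfl⟩ := BraidB.mem_tailsFrom_succ.mp hw
      have hu' : ofBraid q n u ∈ tailSpan q s n m := Submodule.subset_span ⟨u, hu, rfl⟩
      rw [map_mul, mul_assoc]
      rcases lt_trichotomy (j + d) m with h | h | h
      · rw [gen, ← map_mul, (BraidB.commute_desc_sigma_of_lt h).eq, map_mul, ← mul_assoc]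
        exact mul_desc_mem_tailSpan hd (ih (by omega) hs (by omega) hu')
      · have : desc n m d * sigma n j = desc n m (d + 1) := by
          rw [BraidB.desc_succ]; congr 2; omega
        rw [gen, ← map_mul, this]
        exact mul_desc_mem_tailSpan (by omega) hu'
      · rcases Nat.lt_or_ge (m + 1) (j + d) with h' | h'
        · obtain ⟨i, rfl⟩ : ∃ i, j = i + 1 := ⟨j - 1, by omega⟩
          have hsi : s < i := by omega
          rw [gen, ← map_mul, BraidB.desc_mul_sigma (by omega) (by omega) (by omega) (by omega)
            (by omega), map_mul, ← mul_assoc]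
          exact mul_desc_mem_tailSpan hd (ih (by omega) hsi (by omega) hu')
        · obtain ⟨e, rfl⟩ : ∃ e, d = e + 1 := ⟨d - 1, by omega⟩
          have hje : m - e = j := by omega
          have hjn : 1 ≤ j ∧ j < n := by omega
          have : ofBraid q n (desc n m (e + 1)) * gen q n j =
              ((q : K) - 1) • ofBraid q n (desc n m (e + 1)) +
                (q : K) • ofBraid q n (desc n m e) := by
            rw [BraidB.desc_succ, hje, map_mul, mul_assoc]
            change _ * (gen q n j * gen q n j) = _
            rw [gen_mul_self q hjn, mul_add, mul_smul_comm, mul_smul_comm, mul_one]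
            rfl
          rw [this, mul_add, mul_smul_comm, mul_smul_comm]
          exact add_mem (Submodule.smul_mem _ _ (mul_desc_mem_tailSpan hd hu'))
            (Submodule.smul_mem _ _ (mul_desc_mem_tailSpan (by omega) hu'))

theorem mem_tailSpan_of_mem_genSubalgebra {s : ℕ} {x : HeckeB K q n}
    (hx : x ∈ genSubalgebra q s n) : x ∈ tailSpan q s n n := by
  have h1 : (1 : HeckeB K q n) ∈ tailSpan q s n n :=
    Submodule.subset_span ⟨1, BraidB.one_mem_tailsFrom s n, map_one _⟩
  have := Algebra.mul_mem_of_mem_adjoin (V := tailSpan q s n n) (by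
    rintro _ ⟨j, hs, hj, rfl⟩ v hv
    exact mul_gen_mem_tailSpan le_rfl hs hj hv) hx 1 h1
  rwa [one_mul] at this

/-- The finite Hecke algebra is generated, as a left module over the subalgebra generated by
`g_2, …, g_{n-1}`, by the inverses of the blocks `σ_i ⋯ σ_1`. -/
theorem genSubalgebra_le_span (hn : 1 ≤ n) {x : HeckeB K q n} (hx : x ∈ genSubalgebra q 0 n) :
    x ∈ Submodule.span K {y | ∃ h ∈ genSubalgebra q 1 n, ∃ i < n,
      y = h * ofBraid q n (desc n i i)⁻¹} := by
  set C := Submodule.span K {y | ∃ h ∈ genSubalgebra q 1 n, ∃ i < n,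
      y = h * ofBraid q n (desc n i i)⁻¹} with hC
  have hmem (h : HeckeB K q n) (hh : h ∈ genSubalgebra q 1 n) (i : ℕ) (hi : i < n) :
      h * ofBraid q n (desc n i i)⁻¹ ∈ C := Submodule.subset_span ⟨h, hh, i, hi, rfl⟩
  have h1 : (1 : HeckeB K q n) ∈ C := by
    simpa [BraidB.desc_zero] using hmem 1 (one_mem _) 0 hn
  rw [← one_mul x]
  refine Algebra.mul_mem_of_mem_adjoin ?_ hx 1 h1
  rintro _ ⟨j, hj0, hj, rfl⟩ v hv
  induction hv using Submodule.span_induction with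
  | zero => rw [zero_mul]; exact zero_mem _
  | add x y _ _ hx hy => rw [add_mul]; exact add_mem hx hy
  | smul c x _ hx => rw [smul_mul_assoc]; exact Submodule.smul_mem _ _ hx
  | mem x hx =>
    obtain ⟨h, hh, i, hi, rfl⟩ := hx
    -- Moving `g_j` left through `(σ_i ⋯ σ_1)⁻¹` gives `g_{j+1}` if `j < i`, shortens the block if
    -- `j = i`, and commutes if `j > i + 1`. For `j = i + 1`, writing `g_j` through `σ_j⁻¹`
    -- lengthens the block.
    rcases lt_trichotomy j i with hji | rfl | hji
    · have e : (desc n i i)⁻¹ * sigma n j = sigma n (j + 1) * (desc n i i)⁻¹ := by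
        rw [inv_mul_eq_iff_eq_mul, ← mul_assoc, eq_mul_inv_iff_mul_eq,
          BraidB.desc_mul_sigma hi le_rfl (by omega) (by omega) hj0]
      rw [gen, mul_assoc, ← map_mul, e, map_mul, ← mul_assoc]
      exact hmem _ (mul_mem hh (gen_mem_genSubalgebra (by omega) (by omega))) i hi
    · obtain ⟨m, rfl⟩ : ∃ m, j = m + 1 := ⟨j - 1, by omega⟩
      rw [gen, mul_assoc, ← map_mul, BraidB.desc_succ', mul_inv_rev, inv_mul_cancel_right]
      exact hmem h hh m (by omega)
    · rcases Nat.lt_or_ge (i + 1) j with hij | hij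
      · have e : (desc n i i)⁻¹ * sigma n j = sigma n j * (desc n i i)⁻¹ :=
          (BraidB.commute_desc_sigma_of_gt hij).inv_left.eq
        rw [gen, mul_assoc, ← map_mul, e, map_mul, ← mul_assoc]
        exact hmem _ (mul_mem hh (gen_mem_genSubalgebra (by omega) (by omega))) i hi
      · obtain rfl : j = i + 1 := by omega
        rw [gen_eq q (by omega), mul_add, mul_smul_comm, mul_smul_comm, mul_one, mul_assoc,
          ← map_mul, ← mul_inv_rev, ← BraidB.desc_succ']
        exact add_mem (Submodule.smul_mem _ _ (hmem h hh _ hj))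
          (Submodule.smul_mem _ _ (hmem h hh i hi))

/-- Monomials followed by tails span `H_{1,n}(q)`. -/
theorem span_sigmaSet (hn : 1 ≤ n) (x : HeckeB K q n) :
    x ∈ Submodule.span K (ofBraid q n '' BraidB.sigmaSet n) := by
  set V := Submodule.span K (ofBraid q n '' BraidB.sigmaSet n) with hV
  have hmem (k : ℕ → ℤ) {u : HeckeB K q n} (hu : u ∈ genSubalgebra q 0 n) :
      ofBraid q n (monomial n n k) * u ∈ V := by
    replace hu := mem_tailSpan_of_mem_genSubalgebra hu
    induction hu using Submodule.span_induction with
    | zero => rw [mul_zero]; exact zero_mem _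
    | add x y _ _ hx hy => rw [mul_add]; exact add_mem hx hy
    | smul c x _ hx => rw [mul_smul_comm]; exact Submodule.smul_mem _ _ hx
    | mem x hx =>
      obtain ⟨w, hw, rfl⟩ := hx
      rw [← map_mul]
      exact Submodule.subset_span ⟨_, ⟨k, w, hw, rfl⟩, rfl⟩
  have hV_le {W : Submodule K (HeckeB K q n)} (hW : ∀ k, ∀ u ∈ genSubalgebra q 0 n,
      ofBraid q n (monomial n n k) * u ∈ W) : V ≤ W := by
    rw [hV, Submodule.span_le]
    rintro _ ⟨_, ⟨k, w, hw, rfl⟩, rfl⟩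
    rw [map_mul]
    exact hW k _ (ofBraid_tail_mem_genSubalgebra le_rfl hw)
  have hR : ∀ u ∈ genSubalgebra q 0 n, ∀ v ∈ V, v * u ∈ V := fun u hu v hv => by
    refine hV_le (W := V.comap (LinearMap.mulRight K u)) (fun k b hb => ?_) hv
    rw [Submodule.mem_comap, LinearMap.mulRight_apply, mul_assoc]
    exact hmem k (mul_mem hb hu)
  have hL : ∀ i, 1 ≤ i ∧ i < n → ∀ v ∈ V, gen q n i * v ∈ V := fun i hi v hv => by
    refine hV_le (W := V.comap (LinearMap.mulLeft K (gen q n i))) (fun k b hb => ?_) hv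
    rw [Submodule.mem_comap, LinearMap.mulLeft_apply, ← mul_assoc]
    refine hR b hb _ ?_
    obtain ⟨j, rfl⟩ : ∃ j, i = j + 1 := ⟨i - 1, by omega⟩
    exact gen_mul_monomial_mem q
      (fun i hi => hR _ (gen_mem_genSubalgebra (by omega) hi.2))
      (fun k => by simpa using hmem k (one_mem _)) hi.2 k
  -- Powers of `t = t_0` merge into the exponent at `0`.
  have hT (a : ℤ) : ∀ v ∈ V, ofBraid q n (t n ^ a) * v ∈ V := fun v hv => by
    refine hV_le (W := V.comap (LinearMap.mulLeft K (ofBraid q n (t n ^ a)))) (fun k b hb => ?_) hv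
    rw [Submodule.mem_comap, LinearMap.mulLeft_apply, ← mul_assoc, ← map_mul, ← BraidB.loop_zero,
      ← BraidB.monomial_single (show 0 < n by omega), ← BraidB.monomial_add le_rfl]
    exact hmem _ hb
  induction x using induction_on with
  | add x y hx hy => exact add_mem hx hy
  | smul c x hx => exact Submodule.smul_mem _ _ hx
  | ofBraid b =>
    induction b using BraidB.induction_on with
    | one => simpa [BraidB.monomial_zero] using hmem 0 (one_mem _)
    | t_mul x h => rw [map_mul]; simpa using hT 1 _ h
    | t_inv_mul x h => rw [map_mul]; simpa using hT (-1) _ h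
    | sigma_mul i hi x h => rw [map_mul]; exact hL i hi _ h
    | sigma_inv_mul i hi x h =>
      rw [map_mul]
      simpa using ofBraid_zpow_mul_mem q hi (hL i hi) (-1) _ h

end HeckeB

/-! ### From the equations for `L` to all monomials with braiding. -/

namespace HeckeB

open BraidB (sigma t loop desc monomial tailsFrom)

variable {K : Type*} [CommRing K] (q z r : Kˣ) {n : ℕ} (p : ℤ) (M : Submodule K (TraceRing K))

/-- The elements on which both functions `bandDiff` take values in `M`. -/
noncomputable def bandSubmodule (n : ℕ) : Submodule K (HeckeB K q n) :=
  ⨅ ε : ℤˣ, M.comap (bandDiff q z r p ε n)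

variable {q z r p M}

theorem mem_bandSubmodule {x : HeckeB K q n} :
    x ∈ bandSubmodule q z r p M n ↔ ∀ ε, bandDiff q z r p ε n x ∈ M := by
  simp [bandSubmodule]

theorem mul_mem_bandSubmodule_comm {h x : HeckeB K q n} (hh : h ∈ slideSubalgebra q z r p n) :
    h * x ∈ bandSubmodule q z r p M n ↔ x * h ∈ bandSubmodule q z r p M n := by
  rw [mem_bandSubmodule, mem_bandSubmodule]
  exact forall_congr' fun ε => by rw [hh ε x]

theorem genSubalgebra_le_slideSubalgebra (hn : 1 ≤ n) :
    genSubalgebra q 1 n ≤ slideSubalgebra q z r p n := by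
  refine Algebra.adjoin_le ?_
  rintro _ ⟨j, hj, hjn, rfl⟩
  exact gen_mem_slideSubalgebra q z r hn p hj hjn

theorem incl_mem_bandSubmodule (hn : 1 ≤ n) {x : HeckeB K q n}
    (hx : x ∈ bandSubmodule q z r p M n) :
    incl q n x ∈ bandSubmodule q z r p M (n + 1) := by
  rw [mem_bandSubmodule] at hx ⊢
  intro ε
  rw [bandDiff_incl q z r hn]
  exact M.smul_mem _ (hx ε)

theorem incl_mul_gen_mem_bandSubmodule (hn : 1 ≤ n) {x : HeckeB K q n}
    (hx : x ∈ bandSubmodule q z r p M n) :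
    incl q n x * gen q (n + 1) n ∈ bandSubmodule q z r p M (n + 1) := by
  rw [mem_bandSubmodule] at hx ⊢
  intro ε
  rw [bandDiff_incl_mul_gen q z r hn]
  exact M.smul_mem _ (hx ε)

theorem commute_t_of_mem_genSubalgebra (a : ℤ) {h : HeckeB K q n}
    (hh : h ∈ genSubalgebra q 1 n) : Commute h (ofBraid q n (t n ^ a)) := by
  have : genSubalgebra q 1 n ≤ Subalgebra.centralizer K {ofBraid q n (t n ^ a)} := by
    refine Algebra.adjoin_le ?_
    rintro _ ⟨j, hj, _, rfl⟩
    rw [SetLike.mem_coe, Subalgebra.mem_centralizer_iff]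
    rintro _ rfl
    exact (((BraidB.commute_t_sigma hj).zpow_left a).map (ofBraid q n)).eq
  exact ((Subalgebra.mem_centralizer_iff K).mp (this hh) _ rfl).symm

/-- If the elements of `L` followed by braiding tails satisfy the band move equations modulo `M` on
all strands, then so do the nontrivial monomials with braiding on both sides. -/
theorem mul_monomial_mul_mem_bandSubmodule (hn : 1 ≤ n)
    (hM : ∀ β ∈ BraidB.lSet n, ∀ i < n,
      ofBraid q n ((desc n i i)⁻¹ * β * desc n i i) ∈ bandSubmodule q z r p M n)
    {k : ℕ → ℤ} (hk : ∃ i < n, k i ≠ 0) {a b : HeckeB K q n} (ha : a ∈ genSubalgebra q 0 n)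
    (hb : b ∈ genSubalgebra q 0 n) :
    a * ofBraid q n (monomial n n k) * b ∈ bandSubmodule q z r p M n := by
  set W := bandSubmodule q z r p M n with hW
  -- Quantifying over braiding on both sides makes `V` stable under the `g_i` from left and right,
  -- as gap filling requires.
  let V : Submodule K (HeckeB K q n) :=
    ⨅ a : genSubalgebra q 0 n, ⨅ b : genSubalgebra q 0 n,
      W.comap (LinearMap.mulLeftRight K ((a : HeckeB K q n), (b : HeckeB K q n)))
  have hV {v : HeckeB K q n} : v ∈ V ↔
      ∀ a ∈ genSubalgebra q 0 n, ∀ b ∈ genSubalgebra q 0 n, a * v * b ∈ W := by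
    simp [V]
  refine hV.mp (monomial_mem_of_gapfree q ?_ ?_ ?_ k hk) a ha b hb
  · intro i hi v hv
    rw [hV] at hv ⊢
    intro a ha b hb
    have := hv a ha _ (mul_mem (gen_mem_genSubalgebra (s := 0) hi.1 hi.2) hb)
    simpa only [mul_assoc] using this
  · intro i hi v hv
    rw [hV] at hv ⊢
    intro a ha b hb
    have := hv _ (mul_mem ha (gen_mem_genSubalgebra (s := 0) hi.1 hi.2)) b hb
    simpa only [mul_assoc] using this
  · rintro k ⟨m, hm, hk1, hk2⟩
    have hmk : monomial n n k = monomial n (m + 1) k := by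
      rw [BraidB.monomial_congr (l := fun i => if i ≤ m then k i else 0) (fun i hi => ?_),
        BraidB.monomial_eq_of_le (show m + 1 ≤ n from hm) (fun i hi => if_neg (by omega)),
        BraidB.monomial_congr (fun i hi => if_pos (by omega))]
      split_ifs with h
      · rfl
      · exact hk2 i (by omega) hi
    rw [hV]
    intro a ha b hb
    have ha' := genSubalgebra_le_span hn ha
    clear ha
    induction ha' using Submodule.span_induction with
    | zero => rw [zero_mul, zero_mul]; exact zero_mem _
    | add x y _ _ hx hy => rw [add_mul, add_mul]; exact add_mem hx hy
    | smul c x _ hx => rw [smul_mul_assoc, smul_mul_assoc]; exact Submodule.smul_mem _ _ hx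
    | mem x hx =>
      obtain ⟨h, hh, i, hi, rfl⟩ := hx
      have hd := ofBraid_desc_mem_genSubalgebra (q := q) (s := 0) hi (le_refl i)
      have hh0 : h ∈ genSubalgebra q 0 n := genSubalgebra_one_le_zero hh
      -- With `d = σ_i ⋯ σ_1` and `a = h d⁻¹`, the factor `h` slides to the far right. Writing `b h
      -- = (b h d⁻¹) d` and expanding the bracket in tails `w` gives terms `d⁻¹ τ w d`, which are
      -- the hypotheses.
      have hu : b * h * ofBraid q n (desc n i i)⁻¹ ∈ tailSpan q 0 n n :=
        mem_tailSpan_of_mem_genSubalgebra (mul_mem (mul_mem hb hh0) hd.2)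
      rw [mul_assoc, mul_assoc, mul_mem_bandSubmodule_comm
        (genSubalgebra_le_slideSubalgebra hn hh), mul_assoc, mul_assoc]
      have e : b * h = b * h * ofBraid q n (desc n i i)⁻¹ * ofBraid q n (desc n i i) := by
        rw [mul_assoc, ofBraid_inv_mul, mul_one]
      rw [e]
      generalize b * h * ofBraid q n (desc n i i)⁻¹ = u at hu
      induction hu using Submodule.span_induction with
      | zero => simp
      | add x y _ _ hx hy => simp only [add_mul, mul_add]; exact add_mem hx hy
      | smul c x _ hx =>
        simp only [smul_mul_assoc, mul_smul_comm]
        exact Submodule.smul_mem _ _ hx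
      | mem x hx =>
        obtain ⟨w, hw, rfl⟩ := hx
        have := hM _ ⟨m, k, hm, hk1, w, hw, rfl⟩ i hi
        rw [hmk]
        simpa only [map_mul, mul_assoc] using this

/-- As `σ_1⁻¹` is conjugate to `t_0 t_1⁻¹ σ_1` under `t`, the band move equation for `h σ_1⁻¹` is
one for a nontrivial monomial. -/
theorem mul_sigma_inv_mem_bandSubmodule (hn : 2 ≤ n)
    (hM : ∀ β ∈ BraidB.lSet n, ∀ i < n,
      ofBraid q n ((desc n i i)⁻¹ * β * desc n i i) ∈ bandSubmodule q z r p M n)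
    {h : HeckeB K q n} (hh : h ∈ genSubalgebra q 1 n) :
    h * ofBraid q n (sigma n 1)⁻¹ ∈ bandSubmodule q z r p M n := by
  have hh0 : h ∈ genSubalgebra q 0 n := genSubalgebra_one_le_zero hh
  have hm : monomial n n (Pi.single 0 1 + Pi.single 1 (-1)) = t n * (loop n 1)⁻¹ := by
    rw [BraidB.monomial_add le_rfl, BraidB.monomial_single (by omega),
      BraidB.monomial_single (by omega), zpow_one, zpow_neg, zpow_one]
    rfl
  have key := mul_monomial_mul_mem_bandSubmodule (by omega) hM
    (k := Pi.single 0 1 + Pi.single 1 (-1)) ⟨0, by omega, by simp⟩ hh0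
    (gen_mem_genSubalgebra (q := q) (s := 0) (j := 1) (by omega) (by omega))
  have e : (sigma n 1)⁻¹ = t n ^ (-1 : ℤ) * (t n * (loop n 1)⁻¹ * sigma n 1 * t n) := by
    rw [BraidB.loop_succ, BraidB.loop_zero]
    group
  have ht := ofBraid_inv_mem_slideSubalgebra q z r (t_mem_slideSubalgebra q z r
    (show 1 ≤ n by omega) p)
  rw [e, map_mul, ← mul_assoc, (commute_t_of_mem_genSubalgebra (-1) hh).eq, mul_assoc, zpow_neg,
    zpow_one, mul_mem_bandSubmodule_comm ht, map_mul _ _ (t n), ← mul_assoc, mul_assoc,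
    ofBraid_mul_inv, mul_one, map_mul, ← hm, ← mul_assoc]
  exact key

/-- The equation for `σ_1⁻¹` on two strands is already known; removing this negative stabilization
multiplies it by the unit `r`. -/
theorem one_mem_bandSubmodule (hr : (r : K) ^ 2 * (q * z) = z + 1 - q)
    (hM : ∀ β ∈ BraidB.lSet 2, ∀ i < 2,
      ofBraid q 2 ((desc 2 i i)⁻¹ * β * desc 2 i i) ∈ bandSubmodule q z r p M 2) :
    (1 : HeckeB K q 1) ∈ bandSubmodule q z r p M 1 := by
  have h := mul_sigma_inv_mem_bandSubmodule le_rfl hM (one_mem _)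
  rw [mem_bandSubmodule] at h ⊢
  intro ε
  have h := h ε
  rw [← map_one (incl q 1), bandDiff_incl_mul_inv q z r hr le_rfl] at h
  have := M.smul_mem (↑r⁻¹ : K) h
  rwa [smul_smul, Units.inv_mul, one_smul] at this

/-- Induction on strands over tails without `σ_1`. A tail with trivial last block comes from fewer
strands. Otherwise, everything in the last block after its leading crossing slides to the front,
which leaves a Markov stabilization. -/
theorem genSubalgebra_one_le_bandSubmodule (h1 : (1 : HeckeB K q 1) ∈ bandSubmodule q z r p M 1)
    (hn : 1 ≤ n) {x : HeckeB K q n} (hx : x ∈ genSubalgebra q 1 n) :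
    x ∈ bandSubmodule q z r p M n := by
  induction n, hn using Nat.le_induction with
  | base =>
    replace hx := mem_tailSpan_of_mem_genSubalgebra hx
    refine Submodule.span_le.mpr ?_ hx
    rintro _ ⟨w, hw, rfl⟩
    obtain ⟨u, hu, d, hd, rfl⟩ := BraidB.mem_tailsFrom_succ.mp hw
    rw [BraidB.tailsFrom_zero_right] at hu
    obtain rfl : d = 0 := by omega
    rw [Set.mem_singleton_iff.mp hu, BraidB.desc_zero, mul_one, map_one]
    exact h1
  | succ n hn ih =>
    replace hx := mem_tailSpan_of_mem_genSubalgebra hx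
    refine Submodule.span_le.mpr ?_ hx
    rintro _ ⟨w, hw, rfl⟩
    obtain ⟨u, hu, d, hd, rfl⟩ := BraidB.mem_tailsFrom_succ.mp hw
    obtain ⟨u, hu', rfl⟩ := BraidB.exists_incl_of_mem_tailsFrom le_rfl hu
    have hu'' := ofBraid_tail_mem_genSubalgebra (q := q) le_rfl hu'
    rcases d with _ | d
    · rw [BraidB.desc_zero, mul_one, ← incl_ofBraid]
      exact incl_mem_bandSubmodule hn (ih hu'')
    · obtain ⟨m, rfl⟩ : ∃ m, n = m + 1 := ⟨n - 1, by omega⟩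
      have hdm := (ofBraid_desc_mem_genSubalgebra (q := q) (n := m + 1) (s := 1) (i := m) (d := d)
        (by omega) (by omega)).1
      have hds := genSubalgebra_le_slideSubalgebra (z := z) (r := r) (p := p) (by omega)
        (ofBraid_desc_mem_genSubalgebra (q := q) (n := m + 2) (s := 1) (i := m) (d := d)
          (by omega) (by omega)).1
      rw [SetLike.mem_coe, BraidB.desc_succ', ← mul_assoc, map_mul,
        ← mul_mem_bandSubmodule_comm hds, map_mul, ← mul_assoc,
        ← BraidB.incl_desc (n := m + 1) (by omega) (by omega), ← incl_ofBraid, ← incl_ofBraid,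
        ← map_mul]
      exact incl_mul_gen_mem_bandSubmodule hn (ih (mul_mem hdm hu''))

/-- In `h (σ_i ⋯ σ_1)⁻¹` with `i ≥ 1`, all factors but `σ_1⁻¹` lie in the sliding subalgebra and
move to the front, giving the form `h' σ_1⁻¹`. -/
theorem genSubalgebra_le_bandSubmodule (hr : (r : K) ^ 2 * (q * z) = z + 1 - q)
    (hM : ∀ n, 1 ≤ n → ∀ β ∈ BraidB.lSet n, ∀ i < n,
      ofBraid q n ((desc n i i)⁻¹ * β * desc n i i) ∈ bandSubmodule q z r p M n)
    (hn : 1 ≤ n) {x : HeckeB K q n} (hx : x ∈ genSubalgebra q 0 n) :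
    x ∈ bandSubmodule q z r p M n := by
  refine Submodule.span_le.mpr ?_ (genSubalgebra_le_span hn hx)
  rintro _ ⟨h, hh, i, hi, rfl⟩
  rcases i with _ | i
  · rw [BraidB.desc_zero, inv_one, map_one, mul_one]
    exact genSubalgebra_one_le_bandSubmodule
      (one_mem_bandSubmodule hr (hM 2 (by omega))) hn hh
  · have hd := (ofBraid_desc_mem_genSubalgebra (q := q) (n := n) (s := 1) (i := i + 1) (d := i)
      hi (by omega)).2
    have e : i + 1 - i = 1 := by omega
    rw [SetLike.mem_coe, BraidB.desc_succ, e, mul_inv_rev, map_mul, ← mul_assoc,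
      ← mul_mem_bandSubmodule_comm (genSubalgebra_le_slideSubalgebra hn hd), ← mul_assoc]
    exact mul_sigma_inv_mem_bandSubmodule (by omega) (hM n hn) (mul_mem hd hh)

theorem ofBraid_mem_bandSubmodule_iff (hn : 1 ≤ n) {α : BraidB n} :
    ofBraid q n α ∈ bandSubmodule q z r p M n ↔
      ∀ ε, invX q z r n α - invX q z r (n + 1) (BraidB.slFirst p ε α) ∈ M := by
  rw [mem_bandSubmodule]
  refine forall_congr' fun ε => ?_
  rw [invX_sub_invX_slFirst q z r hn, Submodule.smul_mem_iff_of_isUnit _ (Units.isUnit _)]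

end HeckeB

/-! ### Comparison of the two systems. -/

section Systems

variable {K : Type*} [CommRing K] (q z r : Kˣ)

theorem invX_conj {n : ℕ} (hn : 1 ≤ n) (c β : BraidB n) :
    invX q z r n (c⁻¹ * β * c) = invX q z r n β := by
  have h : HeckeB.ofBraid q n c * HeckeB.ofBraid q n c⁻¹ = 1 := HeckeB.ofBraid_mul_inv q c
  have he : BraidB.expSum n (c⁻¹ * β * c) = BraidB.expSum n β := by
    rw [map_mul, map_mul, map_inv, mul_right_comm, inv_mul_cancel, one_mul]
  rw [invX, invX, he, mul_assoc, map_mul (HeckeB.ofBraid q n), markovTrace_comm q z hn,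
    map_mul (HeckeB.ofBraid q n), mul_assoc, h, mul_one]

theorem consequences_sigmaSystem (hr : (r : K) ^ 2 * (q * z) = z + 1 - q) (p : ℤ) :
    consequences (sigmaSystem q z r p) = consequences (lSystem q z r p) := by
  refine le_antisymm (Submodule.span_le.mpr ?_) (Submodule.span_le.mpr ?_)
  · rintro _ ⟨_, ⟨n, hn, α, ⟨k, w, hw, rfl⟩, ε, rfl⟩, rfl⟩
    have hM : ∀ n, 1 ≤ n → ∀ β ∈ BraidB.lSet n, ∀ i < n, HeckeB.ofBraid q n
        ((BraidB.desc n i i)⁻¹ * β * BraidB.desc n i i) ∈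
          HeckeB.bandSubmodule q z r p (consequences (lSystem q z r p)) n := by
      intro n hn β hβ i hi
      rw [HeckeB.ofBraid_mem_bandSubmodule_iff hn]
      intro ε
      rw [invX_conj q z r hn]
      -- Conjugation by `desc n i i` belongs to the strand with number `i + 1`.
      exact Submodule.subset_span
        ⟨_, ⟨n, hn, β, hβ, ε, i + 1, by omega, by omega, rfl⟩, rfl⟩
    refine (HeckeB.ofBraid_mem_bandSubmodule_iff hn).mp ?_ ε
    have hw' := HeckeB.ofBraid_tail_mem_genSubalgebra (q := q) (s := 0) le_rfl hw
    rw [map_mul]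
    by_cases hk : ∃ i < n, k i ≠ 0
    · simpa using HeckeB.mul_monomial_mul_mem_bandSubmodule hn (hM n hn) hk (one_mem _) hw'
    · push Not at hk
      rw [BraidB.monomial_congr (l := 0) hk, BraidB.monomial_zero, map_one, one_mul]
      exact HeckeB.genSubalgebra_le_bandSubmodule hr hM hn hw'
  · rintro _ ⟨_, ⟨n, hn, β, hβ, ε, i, h1, hi, rfl⟩, rfl⟩
    have hW (x : HeckeB K q n) :
        x ∈ HeckeB.bandSubmodule q z r p (consequences (sigmaSystem q z r p)) n := by
      refine Submodule.span_le.mpr ?_ (HeckeB.span_sigmaSet hn x)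
      rintro _ ⟨α, hα, rfl⟩
      refine (HeckeB.ofBraid_mem_bandSubmodule_iff hn).mpr fun ε => ?_
      exact Submodule.subset_span ⟨_, ⟨n, hn, α, hα, ε, rfl⟩, rfl⟩
    have := (HeckeB.ofBraid_mem_bandSubmodule_iff hn).mp (hW (HeckeB.ofBraid q n
      ((BraidB.desc n (i - 1) (i - 1))⁻¹ * β * BraidB.desc n (i - 1) (i - 1)))) ε
    rwa [invX_conj q z r hn] at this

/-- Evaluation at `s` is `K`-linear, so the solutions depend only on the span of the differences. -/
theorem isSolution_iff {A : Type*} [CommRing A] [Algebra K A]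
    (S : Set (TraceRing K × TraceRing K)) (s : {k : ℤ // k ≠ 0} → A) :
    IsSolution S s ↔
      consequences S ≤ LinearMap.ker (MvPolynomial.aeval (R := K) s).toLinearMap := by
  rw [consequences, Submodule.span_le, Set.image_subset_iff]
  refine forall₂_congr fun e _ => ?_
  simp [sub_eq_zero]

end Systems

theorem mainTheorem3 {K : Type*} [CommRing K] (q z r : Kˣ)
    (hr : (r : K) ^ 2 * (q * z) = z + 1 - q) (p : ℤ) :
    consequences (sigmaSystem q z r p) = consequences (lSystem q z r p) ∧
      ∀ {A : Type*} [CommRing A] [Algebra K A] (s : {k : ℤ // k ≠ 0} → A),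
        IsSolution (sigmaSystem q z r p) s ↔ IsSolution (lSystem q z r p) s := by
  refine ⟨consequences_sigmaSystem q z r hr p, fun s => ?_⟩
  rw [isSolution_iff, isSolution_iff, consequences_sigmaSystem q z r hr p]
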